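/- Let $R$ be a commutative ring in which $2$ is invertible (for example the Laurent polynomial ring $\mathbb{Q}[x_1^{\pm1},\dots,x_r^{\pm1},y_1^{\pm1},\dots,y_s^{\pm1}]$ in indeterminates). For finite multisets $X,Y$ of elements of $R$ define $h_n(X|Y)\in R$ by $$\sum_{n\ge 0}h_n(X|Y)\,t^n=\frac{\prod_{y\in Y}(1-yt)}{\prod_{x\in X}(1-xt)},\qquad h_n(X|Y)=0\ \text{ for } n<0 .$$ For a partition $\lambda=(\lambda_1\ge\lambda_2\ge\cdots)$ of length $l=l(\lambda)\ge 1$ and size $|\lambda|=\sum_i\lambda_i$ put $$S_\lambda(X|Y)=\det_{1\le i,j\le l}\bigl(h_{\lambda_i-i+j}(X|Y)\bigr),\qquad S_{[\lambda]}(X|Y)=\det_{1\le i,j\le l}\bigl(h_{\lambda_i-i+j}(X|Y)-h_{\lambda_i-i-j}(X|Y)\bigr),$$ $$S_{\langle\lambda\rangle}(X|Y)=\tfrac12\det_{1\le i,j\le l}\bigl(h_{\lambda_i-i+j}(X|Y)+h_{\lambda_i-i-j+2}(X|Y)\bigr),$$ and $S_\emptyset=S_{[\emptyset]}=S_{\langle\emptyset\rangle}=1$.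 Let $m,a\ge 1$ be integers and let $(m^a)$ be the partition with $a$ parts equal to $m$. Let $\mathcal S_{\square}$ be the set of all partitions $\lambda=(\lambda_1,\dots,\lambda_a)$ with $m\ge\lambda_1\ge\cdots\ge\lambda_a\ge 0$. Let $\mathcal S_{\mathrm v}\subset\mathcal S_\square$ (vertical domino) be the subset defined by $\lambda_1=m,\ \lambda_2=\lambda_3,\ \lambda_4=\lambda_5,\dots,\lambda_{a-1}=\lambda_a$ if $a$ is odd, and by $\lambda_1=\lambda_2,\ \lambda_3=\lambda_4,\dots,\lambda_{a-1}=\lambda_a$ if $a$ is even. Let $\mathcal S_{\mathrm h}\subset\mathcal S_\square$ (horizontal domino) be the subset of those $\lambda$ such that all of $\lambda_1,\dots,\lambda_a$ are odd if $m$ is odd, and all of them are even if $m$ is even. Let $r,s\ge0$, let $x_1,\dots,x_r,y_1,\dots,y_s$ be units of $R$, and write $\mathbf x=\{x_1,\dots,x_r\}$, $\mathbf x^{-1}=\{x_1^{-1},\dots,x_r^{-1}\}$, and similarly $\mathbf y,\mathbf y^{-1}$; $\sqcup$ is the union of multisets. Then: 1. ($\mathfrak{osp}(2r+1|2s)^{(1)}$)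 $$S_{(m^a)}(\mathbf x\sqcup\mathbf x^{-1}|\mathbf y\sqcup\{-1\}\sqcup\mathbf y^{-1})=\sum_{\lambda\in\mathcal S_{\mathrm v}}S_{[\lambda]}(\mathbf x\sqcup\{1\}\sqcup\mathbf x^{-1}|\mathbf y\sqcup\mathbf y^{-1})=\sum_{\lambda\in\mathcal S_\square}S_{[\lambda]}(\mathbf x\sqcup\mathbf x^{-1}|\mathbf y\sqcup\mathbf y^{-1}).$$ 2. ($\mathfrak{sl}(2r|2s+1)^{(2)}$) $$S_{(m^a)}(\mathbf x\sqcup\mathbf x^{-1}|\mathbf y\sqcup\{1\}\sqcup\mathbf y^{-1})=\sum_{\lambda\in\mathcal S_{\mathrm v}}S_{[\lambda]}(\mathbf x\sqcup\{-1\}\sqcup\mathbf x^{-1}|\mathbf y\sqcup\mathbf y^{-1})=\sum_{\lambda\in\mathcal S_\square}(-1)^{ma+|\lambda|}S_{[\lambda]}(\mathbf x\sqcup\mathbf x^{-1}|\mathbf y\sqcup\mathbf y^{-1}).$$ 3. ($\mathfrak{sl}(2r+1|2s)^{(2)}$) $$S_{(m^a)}(\mathbf x\sqcup\{1\}\sqcup\mathbf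 x^{-1}|\mathbf y\sqcup\mathbf y^{-1})=\sum_{\lambda\in\mathcal S_{\mathrm h}}S_{[\lambda]}(\mathbf x\sqcup\{1\}\sqcup\mathbf x^{-1}|\mathbf y\sqcup\mathbf y^{-1})=\sum_{\lambda\in\mathcal S_\square}S_{\langle\lambda\rangle}(\mathbf x\sqcup\mathbf x^{-1}|\mathbf y\sqcup\mathbf y^{-1}).$$ 4. ($\mathfrak{sl}(2r|2s)^{(2)}$) $$S_{(m^a)}(\mathbf x\sqcup\mathbf x^{-1}|\mathbf y\sqcup\mathbf y^{-1})=\sum_{\lambda\in\mathcal S_{\mathrm h}}S_{[\lambda]}(\mathbf x\sqcup\mathbf x^{-1}|\mathbf y\sqcup\mathbf y^{-1})=\sum_{\lambda\in\mathcal S_{\mathrm v}}S_{\langle\lambda\rangle}(\mathbf x\sqcup\mathbf x^{-1}|\mathbf y\sqcup\mathbf y^{-1}).$$ 5. ($\mathfrak{osp}(2r|2s)^{(1)}$) $$S_{(m^a)}(\mathbf x\sqcup\mathbf x^{-1}|\mathbf y\sqcup\{1,-1\}\sqcup\mathbf y^{-1})=\sum_{\lambda\in\mathcal S_{\mathrm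 v}}S_{[\lambda]}(\mathbf x\sqcup\mathbf x^{-1}|\mathbf y\sqcup\mathbf y^{-1}).$$ 6. ($\mathfrak{spo}(2r|2s)^{(1)}$) $$S_{(m^a)}(\mathbf x\sqcup\{1,-1\}\sqcup\mathbf x^{-1}|\mathbf y\sqcup\mathbf y^{-1})=\sum_{\lambda\in\mathcal S_{\mathrm h}}S_{\langle\lambda\rangle}(\mathbf x\sqcup\mathbf x^{-1}|\mathbf y\sqcup\mathbf y^{-1}).$$ 7. ($\mathfrak{osp}(2r|2s)^{(2)}$) If $r\ge1$, then, with $\tilde{\mathbf x}=\{x_1,\dots,x_{r-1}\}$ and $\tilde{\mathbf x}^{-1}=\{x_1^{-1},\dots,x_{r-1}^{-1}\}$, $$S_{(m^a)}(\tilde{\mathbf x}\sqcup\{1,1\}\sqcup\tilde{\mathbf x}^{-1}|\mathbf y\sqcup\{1,-1\}\sqcup\mathbf y^{-1})=S_{(m^a)}(\tilde{\mathbf x}\sqcup\{1\}\sqcup\tilde{\mathbf x}^{-1}|\mathbf y\sqcup\{-1\}\sqcup\mathbf y^{-1})=\sum_{\lambda\in\mathcal S_\square}S_{[\lambda]}(\tilde{\mathbf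 x}\sqcup\{1\}\sqcup\tilde{\mathbf x}^{-1}|\mathbf y\sqcup\mathbf y^{-1}).$$ -/

import Mathlib

/-- The generating series `∏_{y ∈ Y} (1 - y t) / ∏_{x ∈ X} (1 - x t)` of the complete supersymmetric
functions, for finite multisets `X`, `Y` of elements of a commutative ring. The denominator has
constant coefficient `1`, so it is invertible (see `superGen_mul`). -/
noncomputable def superGen {R : Type*} [CommRing R] (X Y : Multiset R) : PowerSeries R :=
  (Y.map fun y => 1 - PowerSeries.C y * PowerSeries.X).prod *
    PowerSeries.invOfUnit (X.map fun x => 1 - PowerSeries.C x * PowerSeries.X).prod 1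

theorem superGen_mul {R : Type*} [CommRing R] (X Y : Multiset R) :
    superGen X Y * (X.map fun x => 1 - PowerSeries.C x * PowerSeries.X).prod =
      (Y.map fun y => 1 - PowerSeries.C y * PowerSeries.X).prod := by
  have h : PowerSeries.constantCoeff
      (X.map fun x : R => 1 - PowerSeries.C x * PowerSeries.X).prod = ((1 : Rˣ) : R) := by
    rw [map_multiset_prod, Multiset.map_map]
    simp
  rw [superGen, mul_assoc, PowerSeries.invOfUnit_mul _ _ h, mul_one]

/-- The complete supersymmetric function `h_n(X|Y)`, for all integers `n`; it is `0` for `n < 0`. -/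
noncomputable def superH {R : Type*} [CommRing R] (X Y : Multiset R) (n : ℤ) : R :=
  if 0 ≤ n then PowerSeries.coeff n.toNat (superGen X Y) else 0

/-! A partition is a `YoungDiagram` `μ`, with parts `μ_i = μ.rowLen (i - 1)` (`i ≥ 1`) and
length `l(μ) = μ.colLen 0`. The matrix indices below start at `0`, whence the shifts
`i + 1`, `j + 1`. -/

/-- The supersymmetric Schur function
`S_μ(X|Y) = det_{1 ≤ i, j ≤ l(μ)} (h_{μ_i - i + j})`. -/
noncomputable def superSchur {R : Type*} [CommRing R] (μ : YoungDiagram) (X Y : Multiset R) : R :=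
  Matrix.det (Matrix.of fun i j : Fin (μ.colLen 0) =>
    superH X Y ((μ.rowLen i : ℤ) - ((i : ℤ) + 1) + ((j : ℤ) + 1)))

/-- `S_[μ](X|Y) = det_{1 ≤ i, j ≤ l(μ)} (h_{μ_i - i + j} - h_{μ_i - i - j})`. -/
noncomputable def superSchurBD {R : Type*} [CommRing R] (μ : YoungDiagram) (X Y : Multiset R) : R :=
  Matrix.det (Matrix.of fun i j : Fin (μ.colLen 0) =>
    superH X Y ((μ.rowLen i : ℤ) - ((i : ℤ) + 1) + ((j : ℤ) + 1)) -
      superH X Y ((μ.rowLen i : ℤ) - ((i : ℤ) + 1) - ((j : ℤ) + 1)))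

open Classical in
/-- `S_⟨μ⟩(X|Y) = (1/2) det_{1 ≤ i, j ≤ l(μ)} (h_{μ_i - i + j} + h_{μ_i - i - j + 2})` for `μ ≠ ∅`,
and `S_⟨∅⟩ = 1`. -/
noncomputable def superSchurC {R : Type*} [CommRing R] [Invertible (2 : R)]
    (μ : YoungDiagram) (X Y : Multiset R) : R :=
  if μ = ⊥ then 1 else
    ⅟(2 : R) * Matrix.det (Matrix.of fun i j : Fin (μ.colLen 0) =>
      superH X Y ((μ.rowLen i : ℤ) - ((i : ℤ) + 1) + ((j : ℤ) + 1)) +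
        superH X Y ((μ.rowLen i : ℤ) - ((i : ℤ) + 1) - ((j : ℤ) + 1) + 2))

/-- The rectangular Young diagram `(m^a)`: `a` rows of length `m`. -/
def rectDiagram (m a : ℕ) : YoungDiagram where
  cells := Finset.range a ×ˢ Finset.range m
  isLowerSet := by
    rintro ⟨i, j⟩ ⟨i', j'⟩ ⟨h1, h2⟩ h
    simp only [Finset.coe_product, Finset.coe_range, Set.mem_prod, Set.mem_Iio] at *
    exact ⟨lt_of_le_of_lt h1 h.1, lt_of_le_of_lt h2 h.2⟩

theorem boxPartitions_finite (m a : ℕ) :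
    {μ : YoungDiagram | μ.colLen 0 ≤ a ∧ μ.rowLen 0 ≤ m}.Finite := by
  refine Set.Finite.of_finite_image (f := YoungDiagram.cells)
    ((Finset.finite_toSet (Finset.range a ×ˢ Finset.range m).powerset).subset ?_)
    (fun μ _ ν _ h => YoungDiagram.ext h)
  rintro _ ⟨μ, ⟨h1, h2⟩, rfl⟩
  rw [Finset.mem_coe, Finset.mem_powerset]
  rintro ⟨i, j⟩ hij
  rw [YoungDiagram.mem_cells] at hij
  have hi := YoungDiagram.mem_iff_lt_colLen.1 hij
  have hj := YoungDiagram.mem_iff_lt_rowLen.1 hij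
  have hi' := μ.colLen_anti 0 j (Nat.zero_le j)
  have hj' := μ.rowLen_anti 0 i (Nat.zero_le i)
  simp only [Finset.mem_product, Finset.mem_range]
  omega

/-- The set `S_□` of all partitions `μ = (μ_1, …, μ_a)` with `m ≥ μ_1 ≥ ⋯ ≥ μ_a ≥ 0`. -/
noncomputable def boxPartitions (m a : ℕ) : Finset YoungDiagram :=
  (boxPartitions_finite m a).toFinset

open Classical in
/-- The subset of `S_□` indexed by the vertical domino:
`m = μ_1`, `μ_2 = μ_3`, …, `μ_{a-1} = μ_a` if `a` is odd, and
`μ_1 = μ_2`, `μ_3 = μ_4`, …, `μ_{a-1} = μ_a` if `a` is even. -/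
noncomputable def verticalDominoPartitions (m a : ℕ) : Finset YoungDiagram :=
  (boxPartitions m a).filter fun μ =>
    (Odd a → μ.rowLen 0 = m ∧ ∀ k : ℕ, 2 * k + 2 < a → μ.rowLen (2 * k + 1) = μ.rowLen (2 * k + 2)) ∧
    (Even a → ∀ k : ℕ, 2 * k + 1 < a → μ.rowLen (2 * k) = μ.rowLen (2 * k + 1))

open Classical in
/-- The subset of `S_□` indexed by the horizontal domino: all of `μ_1, …, μ_a` are odd
(hence `≥ 1`) if `m` is odd, and all of them are even if `m` is even. -/
noncomputable def horizontalDominoPartitions (m a : ℕ) : Finset YoungDiagram :=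
  (boxPartitions m a).filter fun μ =>
    (Odd m → ∀ i : ℕ, i < a → Odd (μ.rowLen i)) ∧
    (Even m → ∀ i : ℕ, i < a → Even (μ.rowLen i))

/-- The multiset `𝐱 ⊔ 𝐱⁻¹ = {x_1, …, x_n, x_1⁻¹, …, x_n⁻¹}`. -/
def withInverses {R : Type*} [CommRing R] {n : ℕ} (x : Fin n → Rˣ) : Multiset R :=
  (Finset.univ.val.map fun i => ((x i : Rˣ) : R)) +
    (Finset.univ.val.map fun i => (((x i)⁻¹ : Rˣ) : R))

/-!
The identities hold for an arbitrary power series `G` with constant coefficient `1` in place of the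
generating series of the `h_n(X|Y)`; that the variables come in inverse pairs is irrelevant. Write
`[μ](G)` for the determinant defining `S_[μ]` and `⟨m^a⟩(F)` for the Jacobi–Trudi determinant of the
rectangle, formed with the coefficients of `G` and `F`. Everything follows from

* `⟨m^a⟩(G) = ∑ [μ](G)` over the horizontal domino partitions (`rectDet_eq_sum_horizontal`),
* `⟨m^a⟩((1 + t) G) = ∑ [μ](G)` over all partitions in the box
  (`rectDet_one_add_X_mul_eq_sum_box`),
* `⟨m^a⟩((1 - t²) G) = ∑ [μ](G)` over the vertical domino partitions
  (`rectDet_one_sub_X_sq_mul_eq_sum_vertical`).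

Indeed adding a variable multiplies or divides the generating series by a linear factor, column
operations give `S_⟨μ⟩(X|Y) = S_[μ](X ⊔ {1, -1}|Y)` (`superSchurC_eq_bracketDet`), and the signed
sum is the second identity after `t ↦ -t` (`rectDet_one_sub_X_mul_eq_sum_box`).

For the three identities, introduce variables `x_1, …, x_a`, let `V` be their Vandermonde
determinant, and put `A = ∏ G(x_i) ∏_{i ≤ j} (1 - x_i x_j)`, a symmetric function. By the Weyl
denominator formula of type C (`det_pow_sub_pow`) the coefficients of `A V` are the determinants
`[μ](G)`. On the other hand, the Littlewood identities (`littlewoodSum_even_mul`,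
`littlewoodSum_true_mul`, `littlewoodSum_vertical_mul`) expand
`V / (∏ d(x_i) ∏_{i < j} (1 - x_i x_j))`, with `d = 1 - t²`, `1 - t`, `1` respectively, as a sum of
alternants `det (x_i ^ e_j)`, over the partitions with even parts, all partitions, and the
partitions with columns of even length. Multiplying by `A` turns this into
`∏ F(x_i) V`, where `F d = (1 - t²) G`, and the coefficient of `∏ x_i ^ (m + i - 1)` in it is
`⟨m^a⟩(F)`. Finally, the coefficient of this monomial in the product of a symmetric function with
an alternant is the coefficient of the monomial of the complementary partition in the product with
`V` (`coeff_mul_det_pow_duality`), which turns the sum of alternants into a sum of determinants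
`[μ](G)`, `μ` running over the complements.

Only exponents below `m + a` matter, so the computation takes place in
`R[x_1, …, x_a] / (x_1 ^ (m + a), …, x_a ^ (m + a))`, where all sums are finite. The Littlewood
identities are proved there by induction on `a`: the sum over the smallest exponent is a geometric
series in the product of all variables, and the induction step is a Lagrange interpolation identity.
-/

section

open Matrix Finset

/-! ### A Vandermonde form of Lagrange interpolation -/

/-- Lagrange interpolation of `q(w) / w` at the nodes `y_i`, with denominators cleared: the left
side is the Laplace expansion of the Vandermonde determinant whose column of ones is replaced by the
values of `q`, and this column is a combination of the columns `y_i ^ k`. -/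
theorem sum_vandermonde_succAbove_mul_eval {S : Type*} [CommRing S] {n : ℕ} (y : Fin (n + 1) → S)
    (q : Polynomial S) (hq : q.natDegree < n + 1) :
    ∑ i : Fin (n + 1), (-1) ^ (i : ℕ) * (∏ l, y (i.succAbove l)) *
      (vandermonde (y ∘ i.succAbove)).det * q.eval (y i) = q.coeff 0 * (vandermonde y).det := by
  have h := det_updateCol_sum (vandermonde y) 0 (fun i => q.coeff i)
  rw [det_succ_column_zero] at h
  simp only [Fin.val_zero, smul_eq_mul] at h
  rw [← h]
  refine Finset.sum_congr rfl fun i _ => ?_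
  have h1 : ((vandermonde y).updateCol 0 (fun k => ∑ i : Fin (n + 1), q.coeff i *
      vandermonde y k i)).submatrix i.succAbove Fin.succ =
      of fun l j => y (i.succAbove l) * vandermonde (y ∘ i.succAbove) l j := by
    ext l j
    simp [pow_succ']
  rw [h1, det_mul_column, updateCol_self, Polynomial.eval_eq_sum_range' hq,
    Finset.sum_range fun k => q.coeff k * y i ^ k]
  simp only [vandermonde_apply]
  ring

/-! ### The product over pairs -/

/-- The product `∏_{i < j} (1 - x_i x_j)`. -/
def pairProd {S : Type*} [CommRing S] {n : ℕ} (x : Fin n → S) : S :=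
  ∏ i, ∏ j ∈ Ioi i, (1 - x i * x j)

theorem pairProd_succ {S : Type*} [CommRing S] {n : ℕ} (x : Fin (n + 1) → S) :
    pairProd x = (∏ l : Fin n, (1 - x 0 * x l.succ)) * pairProd fun l : Fin n => x l.succ := by
  simp only [pairProd, Fin.prod_univ_succ, Fin.prod_Ioi_zero, Fin.prod_Ioi_succ]

/-- The factors of `pairProd x` that involve a chosen variable `x i` can be split off. -/
theorem pairProd_succAbove {S : Type*} [CommRing S] {n : ℕ} (x : Fin (n + 1) → S)
    (i : Fin (n + 1)) :
    pairProd x =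
      (∏ l, (1 - x (i.succAbove l) * x i)) * pairProd (x ∘ i.succAbove) := by
  induction n with
  | zero =>
    simp [pairProd]
  | succ n ih =>
    induction i using Fin.cases with
    | zero =>
      rw [pairProd_succ]
      simp only [Fin.succAbove_zero, mul_comm]
      rfl
    | succ i =>
      rw [pairProd_succ, ih (fun l => x l.succ) i, pairProd_succ (x ∘ _),
        Fin.prod_univ_succ (fun l => 1 - x (i.succ.succAbove l) * x i.succ),
        Fin.prod_univ_succAbove (fun l : Fin (n + 1) => 1 - x 0 * x l.succ) i]
      simp only [Function.comp_def, Fin.succ_succAbove_zero, Fin.succ_succAbove_succ]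
      ring

theorem pairProd_comp_perm {S : Type*} [CommRing S] {n : ℕ} (x : Fin n → S)
    (σ : Equiv.Perm (Fin n)) : pairProd (x ∘ σ) = pairProd x := by
  induction n with
  | zero => simp [pairProd]
  | succ n ih =>
    have hne : ∀ l : Fin n, ∃ k, (σ 0).succAbove k = σ l.succ := fun l =>
      Fin.exists_succAbove_eq fun h => Fin.succ_ne_zero l (σ.injective h)
    choose f hf using hne
    have hinj : Function.Injective f := fun k l h =>
      Fin.succ_injective _ (σ.injective (by rw [← hf, ← hf, h]))
    let τ : Equiv.Perm (Fin n) := Equiv.ofBijective f (Finite.injective_iff_bijective.1 hinj)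
    rw [pairProd_succAbove (x ∘ σ) 0, pairProd_succAbove x (σ 0), ← ih (x ∘ (σ 0).succAbove) τ,
      ← Equiv.prod_comp τ fun l => 1 - x ((σ 0).succAbove l) * x (σ 0)]
    simp only [Function.comp_def, Fin.succAbove_zero, τ, Equiv.ofBijective_apply, hf]

/-! ### Littlewood sums of alternants -/

/-- The partial sums `d_0 + ⋯ + d_j`. The sequences `j ↦ gapSum d j + j` are exactly the strictly
increasing sequences of natural numbers. -/
def gapSum {a : ℕ} (d : Fin a → ℕ) (j : Fin a) : ℕ := ∑ l, if l ≤ j then d l else 0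

theorem gapSum_cons_zero {a : ℕ} (c : ℕ) (d : Fin a → ℕ) :
    gapSum (Fin.cons c d : Fin (a + 1) → ℕ) 0 = c := by
  simp [gapSum]

theorem gapSum_cons_succ {a : ℕ} (c : ℕ) (d : Fin a → ℕ) (j : Fin a) :
    gapSum (Fin.cons c d : Fin (a + 1) → ℕ) j.succ = c + gapSum d j := by
  simp [gapSum, Fin.sum_univ_succ]

open Classical in
/-- The sum of the alternants `det (x_i ^ e_j)` over strictly increasing exponent sequences
`e_j = d_0 + ⋯ + d_j + j`, where every `d_j < N` and `d_j` satisfies the condition `p (a - j)`; here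
`a - j` is the number of exponents that `d_j` raises. Some `e_j` may be `N` or more, but these terms
vanish as soon as `x_i ^ N = 0`. -/
noncomputable def littlewoodSum {S : Type*} [CommRing S] (p : ℕ → ℕ → Prop) (N : ℕ) {a : ℕ}
    (x : Fin a → S) : S :=
  ∑ d : Fin a → Fin N, if ∀ j : Fin a, p (a - j) (d j) then
    det (of fun i j : Fin a => x i ^ (gapSum (fun l => (d l : ℕ)) j + j)) else 0

/-- Expansion of an alternant with smallest exponent `c` along the corresponding column. -/
theorem det_pow_cons {S : Type*} [CommRing S] {a : ℕ} (x : Fin (a + 1) → S) (c : ℕ)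
    (e : Fin a → ℕ) :
    det (of fun i j : Fin (a + 1) => x i ^ (Fin.cons c (fun l => c + 1 + e l) : Fin (a + 1) → ℕ) j)
      = (∏ i, x i) ^ c * ∑ i : Fin (a + 1), (-1) ^ (i : ℕ) * (∏ l, x (i.succAbove l)) *
        det (of fun k l : Fin a => x (i.succAbove k) ^ e l) := by
  have h : (of fun i j : Fin (a + 1) =>
      x i ^ (Fin.cons c (fun l => c + 1 + e l) : Fin (a + 1) → ℕ) j) =
      of fun i j => x i ^ c *
        (of fun i j => x i ^ (Fin.cons 0 (fun l => 1 + e l) : Fin (a + 1) → ℕ) j) i j := by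
    ext i j
    induction j using Fin.cases <;> simp [← pow_add, add_assoc]
  rw [h, det_mul_column, Finset.prod_pow, det_succ_column_zero]
  congr 1
  refine Finset.sum_congr rfl fun i _ => ?_
  rw [mul_assoc _ (∏ l, _), ← det_mul_column]
  simp only [of_apply, Fin.cons_zero, pow_zero, mul_one]
  congr 2
  ext k l
  simp [pow_add]

/-- Recursion on the number of variables: the smallest exponent contributes a geometric series in
the product of all variables. -/
theorem littlewoodSum_succ {S : Type*} [CommRing S] (p : ℕ → ℕ → Prop) (N : ℕ) {a : ℕ}
    (x : Fin (a + 1) → S) [DecidablePred (p (a + 1))] :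
    littlewoodSum p N x = (∑ c ∈ range N, if p (a + 1) c then (∏ i, x i) ^ c else 0) *
      ∑ i : Fin (a + 1), (-1) ^ (i : ℕ) * (∏ l, x (i.succAbove l)) *
        littlewoodSum p N (x ∘ i.succAbove) := by
  classical
  rw [littlewoodSum, ← (Fin.consEquiv fun _ => Fin N).sum_comp, Fintype.sum_prod_type,
    Finset.sum_range fun c => if p (a + 1) c then (∏ i, x i) ^ c else 0, Finset.sum_mul]
  refine Finset.sum_congr rfl fun c _ => ?_
  simp only [littlewoodSum, Finset.mul_sum]
  rw [Finset.sum_comm]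
  refine Finset.sum_congr rfl fun d _ => ?_
  have h1 : (fun l => ((Fin.consEquiv (fun _ : Fin (a + 1) => Fin N) (c, d) l : Fin N) : ℕ)) =
      Fin.cons (c : ℕ) fun l => (d l : ℕ) := by
    ext l
    induction l using Fin.cases <;> simp [Fin.consEquiv]
  have h2 : (fun i j : Fin (a + 1) =>
      x i ^ (gapSum (Fin.cons (c : ℕ) fun l => (d l : ℕ) : Fin (a + 1) → ℕ) j + j)) =
      fun i j => x i ^ (Fin.cons (c : ℕ) (fun l => c + 1 + (gapSum (fun l => (d l : ℕ)) l + l)) :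
        Fin (a + 1) → ℕ) j := by
    ext i j
    congr 1
    induction j using Fin.cases
    · simp [gapSum_cons_zero]
    · simp [gapSum_cons_succ]; ring
  simp only [h1, h2, det_pow_cons, Fin.forall_fin_succ]
  have h3 : (p (a + 1 - (0 : Fin (a + 1)))
        (Fin.consEquiv (fun _ : Fin (a + 1) => Fin N) (c, d) 0 : Fin N) ∧
      ∀ i : Fin a, p (a + 1 - (i.succ : Fin (a + 1)))
        (Fin.consEquiv (fun _ : Fin (a + 1) => Fin N) (c, d) i.succ : Fin N)) ↔
      p (a + 1) c ∧ ∀ i : Fin a, p (a - i) (d i) := by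
    simp [Fin.consEquiv]
  simp only [h3]
  by_cases hc : p (a + 1) c <;> by_cases hd : ∀ i : Fin a, p (a - i) (d i) <;>
    simp [hc, hd, Finset.mul_sum]

/-- A Littlewood identity holds as soon as its induction step, an identity of Lagrange type, does.
-/
theorem littlewoodSum_mul_of_step {S : Type*} [CommRing S] (p : ℕ → ℕ → Prop)
    [∀ n, DecidablePred (p n)] (N : ℕ) (δ : S → S)
    (hp : ∀ {n : ℕ} (x : Fin (n + 1) → S), (∀ i, x i ^ N = 0) →
      (∑ c ∈ range N, if p (n + 1) c then (∏ i, x i) ^ c else 0) *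
        ∑ i : Fin (n + 1), (-1) ^ (i : ℕ) * (∏ l, x (i.succAbove l)) *
          (vandermonde (x ∘ i.succAbove)).det *
            (δ (x i) * ∏ l, (1 - x (i.succAbove l) * x i)) = (vandermonde x).det)
    {a : ℕ} (x : Fin a → S) (hx : ∀ i, x i ^ N = 0) :
    littlewoodSum p N x * ((∏ i, δ (x i)) * pairProd x) = (vandermonde x).det := by
  induction a with
  | zero => simp [littlewoodSum, pairProd]
  | succ a ih =>
    rw [littlewoodSum_succ, mul_assoc, ← hp x hx]
    congr 1
    rw [Finset.sum_mul]
    refine Finset.sum_congr rfl fun i _ => ?_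
    rw [← ih (x ∘ i.succAbove) (fun l => hx _), pairProd_succAbove x i,
      Fin.prod_univ_succAbove (fun l => δ (x l)) i]
    simp only [Function.comp_apply]
    ring

/-! ### Interpolation identities behind the three Littlewood identities -/

theorem sum_range_pow_mul_one_sub {S : Type*} [CommRing S] (N : ℕ) (z : S) (hz : z ^ N = 0) :
    (∑ c ∈ range N, z ^ c) * (1 - z) = 1 := by
  rw [geom_sum_mul_neg, hz, sub_zero]

theorem sum_range_even_pow_mul_one_sub_sq {S : Type*} [CommRing S] (N : ℕ) (z : S)
    (hz : z ^ N = 0) : (∑ c ∈ range N, if Even c then z ^ c else 0) * (1 - z ^ 2) = 1 := by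
  have h : ∀ n, (∑ c ∈ range n, if Even c then z ^ c else 0) * (1 - z ^ 2) =
      1 - if Even n then z ^ n else z ^ (n + 1) := by
    intro n
    induction n with
    | zero => simp
    | succ n ih =>
      rw [Finset.sum_range_succ, add_mul, ih]
      by_cases hn : Even n <;> simp [hn, Nat.even_add_one]; ring
  rw [h, pow_succ, hz]
  simp

theorem det_vandermonde_cons {S : Type*} [CommRing S] {n : ℕ} (e : S) (x : Fin n → S) :
    (vandermonde (Fin.cons e x : Fin (n + 1) → S)).det =
      (∏ l, (x l - e)) * (vandermonde x).det := by
  simp only [det_vandermonde, Fin.prod_univ_succ, Fin.prod_Ioi_zero, Fin.prod_Ioi_succ,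
    Fin.cons_zero, Fin.cons_succ]

theorem cons_comp_succ_succAbove {S : Type*} {n : ℕ} (e : S) (x : Fin (n + 1) → S)
    (i : Fin (n + 1)) :
    (Fin.cons e x : Fin (n + 2) → S) ∘ i.succ.succAbove = Fin.cons e (x ∘ i.succAbove) := by
  ext l
  induction l using Fin.cases <;> simp

/-- The polynomial `∏_l (1 - x_l w)` in `w`. -/
noncomputable def reciprocalNodal {S : Type*} [CommRing S] {n : ℕ} (x : Fin n → S) :
    Polynomial S :=
  ∏ l, (1 - Polynomial.C (x l) * Polynomial.X)

theorem natDegree_one_sub_C_mul_X_le {S : Type*} [CommRing S] (x : S) :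
    (1 - Polynomial.C x * Polynomial.X).natDegree ≤ 1 := by
  compute_degree

theorem natDegree_reciprocalNodal_le {S : Type*} [CommRing S] {n : ℕ} (x : Fin n → S) :
    (reciprocalNodal x).natDegree ≤ n := by
  refine (Polynomial.natDegree_prod_le _ _).trans ?_
  refine (Finset.sum_le_card_nsmul _ _ 1 fun l _ => natDegree_one_sub_C_mul_X_le _).trans ?_
  simp

theorem eval_reciprocalNodal {S : Type*} [CommRing S] {n : ℕ} (x : Fin n → S) (w : S) :
    (reciprocalNodal x).eval w = ∏ l, (1 - x l * w) := by
  simp [reciprocalNodal, Polynomial.eval_prod]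

theorem coeff_zero_reciprocalNodal {S : Type*} [CommRing S] {n : ℕ} (x : Fin n → S) :
    (reciprocalNodal x).coeff 0 = 1 := by
  rw [Polynomial.coeff_zero_eq_eval_zero, eval_reciprocalNodal]
  simp

theorem coeff_reciprocalNodal {S : Type*} [CommRing S] {n : ℕ} (x : Fin n → S) :
    (reciprocalNodal x).coeff n = (-1) ^ n * ∏ l, x l := by
  have h := Polynomial.coeff_prod_of_natDegree_le (univ : Finset (Fin n))
    (fun l => 1 - Polynomial.C (x l) * Polynomial.X) 1
    (fun l _ => natDegree_one_sub_C_mul_X_le (x l))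
  rw [Finset.card_univ, Fintype.card_fin, mul_one] at h
  rw [reciprocalNodal, h]
  simp [Polynomial.coeff_one, Finset.prod_neg]

theorem eval_reciprocalNodal_self {S : Type*} [CommRing S] {n : ℕ} (x : Fin (n + 1) → S)
    (i : Fin (n + 1)) : (reciprocalNodal x).eval (x i) =
      (1 - x i ^ 2) * ∏ l, (1 - x (i.succAbove l) * x i) := by
  rw [eval_reciprocalNodal, Fin.prod_univ_succAbove _ i, sq]

/-- The interpolation identity for the polynomial `∏_l (1 - x_l w)`. Its degree is the number of
nodes, one too many, so a multiple of `∏_l (w - x_l)`, which vanishes at the nodes, is subtracted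
first. -/
theorem sum_vandermonde_succAbove_even {S : Type*} [CommRing S] {n : ℕ} (x : Fin (n + 1) → S) :
    ∑ i : Fin (n + 1), (-1) ^ (i : ℕ) * (∏ l, x (i.succAbove l)) *
      (vandermonde (x ∘ i.succAbove)).det *
        ((1 - x i ^ 2) * ∏ l, (1 - x (i.succAbove l) * x i)) =
      (1 - (∏ l, x l) ^ 2) * (vandermonde x).det := by
  set c : S := (-1) ^ (n + 1) * ∏ l, x l with hc
  set M : Polynomial S := ∏ l, (Polynomial.X - Polynomial.C (x l)) with hM
  have hMd : M.natDegree ≤ n + 1 := by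
    refine (Polynomial.natDegree_prod_le _ _).trans ?_
    refine (Finset.sum_le_card_nsmul _ _ 1 fun l _ => Polynomial.natDegree_X_sub_C_le _).trans ?_
    simp
  have hMc : M.coeff (n + 1) = 1 := by
    have h := Polynomial.coeff_prod_of_natDegree_le (univ : Finset (Fin (n + 1)))
      (fun l => Polynomial.X - Polynomial.C (x l)) 1
      (fun l _ => Polynomial.natDegree_X_sub_C_le _)
    rw [Finset.card_univ, Fintype.card_fin, mul_one] at h
    rw [hM, h]
    simp
  have hM0 : M.coeff 0 = c := by
    rw [Polynomial.coeff_zero_eq_eval_zero, hM, Polynomial.eval_prod, hc]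
    simp [Finset.prod_neg]
  -- The coefficients of `w ^ (n + 1)` cancel.
  have hdeg : (reciprocalNodal x - Polynomial.C c * M).natDegree < n + 1 := by
    have hle : (reciprocalNodal x - Polynomial.C c * M).natDegree ≤ n + 1 :=
      (Polynomial.natDegree_sub_le _ _).trans
        (max_le (natDegree_reciprocalNodal_le x) ((Polynomial.natDegree_C_mul_le _ _).trans hMd))
    refine lt_of_le_of_ne hle fun h => ?_
    have h0 : (reciprocalNodal x - Polynomial.C c * M).coeff (n + 1) = 0 := by
      rw [Polynomial.coeff_sub, Polynomial.coeff_C_mul, hMc, coeff_reciprocalNodal, hc]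
      ring
    have h1 := congrArg Polynomial.natDegree
      (Polynomial.leadingCoeff_eq_zero.1 ((congrArg _ h).trans h0))
    rw [h] at h1
    simp at h1
  have h := sum_vandermonde_succAbove_mul_eval x _ hdeg
  rw [Polynomial.coeff_sub, Polynomial.coeff_C_mul, hM0, coeff_zero_reciprocalNodal] at h
  have hcc : c * c = (∏ l, x l) ^ 2 := by
    rw [hc, mul_mul_mul_comm, ← mul_pow]; simp [sq]
  rw [← hcc, ← h]
  refine Finset.sum_congr rfl fun i _ => ?_
  have hMi : M.eval (x i) = 0 := by
    rw [hM, Polynomial.eval_prod]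
    exact Finset.prod_eq_zero (mem_univ i) (by simp)
  rw [Polynomial.eval_sub, Polynomial.eval_C_mul, hMi, eval_reciprocalNodal_self]
  ring

/-- The interpolation identity for `∏_l (1 - x_l w)` at the nodes `x_l` and the extra node `-1`,
divided by the unit `∏_l (1 + x_l)`. -/
theorem sum_vandermonde_succAbove_box {S : Type*} [CommRing S] {n : ℕ} (x : Fin (n + 1) → S)
    (hx : ∀ i, IsNilpotent (x i)) :
    ∑ i : Fin (n + 1), (-1) ^ (i : ℕ) * (∏ l, x (i.succAbove l)) *
      (vandermonde (x ∘ i.succAbove)).det *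
        ((1 - x i) * ∏ l, (1 - x (i.succAbove l) * x i)) =
      (1 - ∏ l, x l) * (vandermonde x).det := by
  have h := sum_vandermonde_succAbove_mul_eval (Fin.cons (-1) x : Fin (n + 2) → S)
    (reciprocalNodal x) (Nat.lt_succ_of_le (natDegree_reciprocalNodal_le x))
  rw [Fin.sum_univ_succ, coeff_zero_reciprocalNodal, det_vandermonde_cons] at h
  simp only [cons_comp_succ_succAbove, det_vandermonde_cons, Fin.cons_succ, Fin.cons_zero,
    eval_reciprocalNodal_self] at h
  have hu : IsUnit (∏ l, (x l - -1)) := by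
    refine IsUnit.prod_univ_iff.2 fun l => ?_
    rw [sub_neg_eq_add, add_comm]
    exact (hx l).isUnit_one_add
  refine hu.mul_left_cancel ?_
  have h0 : (Fin.cons (-1) x : Fin (n + 2) → S) ∘ (0 : Fin (n + 2)).succAbove = x := by
    ext l; simp
  rw [h0] at h
  simp only [Fin.succAbove_zero, Fin.cons_succ, eval_reciprocalNodal, Fin.val_zero, pow_zero,
    one_mul] at h
  have h1 : ∏ l, (1 - x l * -1) = ∏ l, (x l - -1) := Finset.prod_congr rfl fun l _ => by ring
  rw [h1] at h
  rw [sub_mul, one_mul, mul_sub, ← h, mul_sum]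
  rw [eq_sub_iff_add_eq, add_comm]
  congr 1
  · ring
  · refine Finset.sum_congr rfl fun i _ => ?_
    rw [Fin.prod_univ_succAbove (fun l => x l - -1) i, Fin.prod_univ_succ]
    simp only [Fin.succ_succAbove_zero, Fin.cons_zero, Fin.succ_succAbove_succ, Fin.cons_succ,
      Fin.val_succ, Function.comp_apply]
    ring

/-- The interpolation identity for `∏_l (1 - x_l w)` at the nodes `x_l` and the extra nodes `1`,
`-1`, divided by the unit `∏_l (x_l + 1) (x_l - 1)`. -/
theorem sum_vandermonde_succAbove_vertical {S : Type*} [CommRing S] {n : ℕ}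
    (x : Fin (n + 1) → S) (hx : ∀ i, IsNilpotent (x i)) :
    2 * ∑ i : Fin (n + 1), (-1) ^ (i : ℕ) * (∏ l, x (i.succAbove l)) *
      (vandermonde (x ∘ i.succAbove)).det * (∏ l, (1 - x (i.succAbove l) * x i)) =
      (2 - (1 + (-1) ^ (n + 1)) * ∏ l, x l) * (vandermonde x).det := by
  have h := sum_vandermonde_succAbove_mul_eval (Fin.cons (-1) (Fin.cons 1 x) : Fin (n + 3) → S)
    (reciprocalNodal x) ((natDegree_reciprocalNodal_le x).trans_lt (by omega))
  rw [Fin.sum_univ_succ, Fin.sum_univ_succ, coeff_zero_reciprocalNodal] at h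
  have h0 : ∀ (m : ℕ) (e : S) (x : Fin (m + 1) → S),
      (Fin.cons e x : Fin (m + 2) → S) ∘ (0 : Fin (m + 2)).succAbove = x := by
    intro m e x; ext l; simp
  simp only [cons_comp_succ_succAbove, h0, det_vandermonde_cons, Fin.cons_succ, Fin.cons_zero,
    eval_reciprocalNodal_self] at h
  have hu : IsUnit (∏ l, (x l - -1)) := by
    refine IsUnit.prod_univ_iff.2 fun l => ?_
    rw [sub_neg_eq_add, add_comm]
    exact (hx l).isUnit_one_add
  have hv : IsUnit (∏ l, (x l - 1)) := by
    refine IsUnit.prod_univ_iff.2 fun l => ?_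
    exact (hx l).isUnit_sub_one
  refine (hu.mul hv).mul_left_cancel ?_
  have h1 : ∏ l, (1 - x l * -1) = ∏ l, (x l - -1) := Finset.prod_congr rfl fun l _ => by ring
  have h1' : ∏ l, (1 - x l * 1) = (-1) ^ (n + 1) * ∏ l, (x l - 1) := by
    have := Finset.prod_neg (s := univ) (fun l => x l - 1)
    simp only [Finset.card_univ, Fintype.card_fin] at this
    rw [← this]
    exact Finset.prod_congr rfl fun l _ => by ring
  simp only [Fin.succAbove_zero, Fin.cons_succ, eval_reciprocalNodal, Fin.val_zero, pow_zero,
    one_mul, h1, h1', Fin.prod_univ_succ (fun l : Fin (n + 1 + 1) => _), Fin.cons_zero,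
    Fin.succ_succAbove_zero, Fin.succ_succAbove_succ, Fin.val_succ] at h
  have key : (∏ l, (x l - -1)) * (∏ l, (x l - 1)) *
      (2 * ∑ i : Fin (n + 1), (-1) ^ (i : ℕ) * (∏ l, x (i.succAbove l)) *
        (vandermonde (x ∘ i.succAbove)).det * ∏ l, (1 - x (i.succAbove l) * x i)) =
      ∑ i : Fin (n + 1), (-1) ^ ((i : ℕ) + 1 + 1) *
        (-1 * ∏ l, (Fin.cons 1 x : Fin (n + 2) → S) (i.succ.succAbove l)) *
        ((∏ l, ((Fin.cons 1 (x ∘ i.succAbove) : Fin (n + 1) → S) l - -1)) *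
          ((∏ l, ((x ∘ i.succAbove) l - 1)) * (vandermonde (x ∘ i.succAbove)).det)) *
        ((1 - x i ^ 2) * ∏ l, (1 - x (i.succAbove l) * x i)) := by
    rw [mul_sum, mul_sum]
    refine Finset.sum_congr rfl fun i _ => ?_
    rw [Fin.prod_univ_succAbove (fun l => x l - -1) i, Fin.prod_univ_succAbove (fun l => x l - 1) i,
      Fin.prod_univ_succ (fun l => (Fin.cons 1 x : Fin (n + 2) → S) (i.succ.succAbove l)),
      Fin.prod_univ_succ (fun l => (Fin.cons 1 (x ∘ i.succAbove) : Fin (n + 1) → S) l - -1)]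
    simp only [Fin.succ_succAbove_zero, Fin.cons_zero, Fin.succ_succAbove_succ, Fin.cons_succ,
      Function.comp_apply]
    ring
  linear_combination h + key

/-! ### The three Littlewood identities -/

theorem prod_pow_eq_zero_of_pow_eq_zero {S : Type*} [CommRing S] {N n : ℕ} {x : Fin (n + 1) → S}
    (hx : ∀ i, x i ^ N = 0) : (∏ i, x i) ^ N = 0 := by
  rw [← Finset.prod_pow]
  exact Finset.prod_eq_zero (mem_univ 0) (hx 0)

/-- Littlewood's identity for the partitions with even parts,
`∑ s_μ = ∏_{i ≤ j} (1 - x_i x_j)⁻¹`, multiplied by the Vandermonde determinant. -/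
theorem littlewoodSum_even_mul {S : Type*} [CommRing S] {N a : ℕ} (x : Fin a → S)
    (hx : ∀ i, x i ^ N = 0) :
    littlewoodSum (fun _ c => Even c) N x * ((∏ i, (1 - x i ^ 2)) * pairProd x) =
      (vandermonde x).det := by
  refine littlewoodSum_mul_of_step _ N (fun t => 1 - t ^ 2) (fun x hx => ?_) x hx
  rw [sum_vandermonde_succAbove_even, ← mul_assoc,
    sum_range_even_pow_mul_one_sub_sq N _ (prod_pow_eq_zero_of_pow_eq_zero hx), one_mul]

/-- Littlewood's identity for all partitions,
`∑ s_μ = ∏_i (1 - x_i)⁻¹ ∏_{i < j} (1 - x_i x_j)⁻¹`, multiplied by the Vandermonde determinant. -/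
theorem littlewoodSum_true_mul {S : Type*} [CommRing S] {N a : ℕ} (x : Fin a → S)
    (hx : ∀ i, x i ^ N = 0) :
    littlewoodSum (fun _ _ => True) N x * ((∏ i, (1 - x i)) * pairProd x) =
      (vandermonde x).det := by
  refine littlewoodSum_mul_of_step _ N (fun t => 1 - t) (fun x hx => ?_) x hx
  rw [sum_vandermonde_succAbove_box x fun i => ⟨N, hx i⟩, ← mul_assoc]
  simp only [if_true]
  rw [sum_range_pow_mul_one_sub N _ (prod_pow_eq_zero_of_pow_eq_zero hx), one_mul]

/-- Littlewood's identity for the partitions with columns of even length,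
`∑ s_μ = ∏_{i < j} (1 - x_i x_j)⁻¹`, multiplied by the Vandermonde determinant. -/
theorem littlewoodSum_vertical_mul {S : Type*} [CommRing S] (h2 : IsUnit (2 : S)) {N a : ℕ}
    (x : Fin a → S) (hx : ∀ i, x i ^ N = 0) :
    littlewoodSum (fun r c => Odd r → c = 0) N x * pairProd x = (vandermonde x).det := by
  have h := littlewoodSum_mul_of_step (fun r c => Odd r → c = 0) N (fun _ : S => 1)
    (fun {n} x hx => ?_) x hx
  · simpa using h
  refine h2.mul_left_cancel ?_
  have h := sum_vandermonde_succAbove_vertical x fun i => ⟨N, hx i⟩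
  simp only [one_mul]
  rw [mul_left_comm, h]
  have hz := prod_pow_eq_zero_of_pow_eq_zero hx
  rcases Nat.even_or_odd (n + 1) with hn | hn
  · have hn' : ¬ Odd (n + 1) := Nat.not_odd_iff_even.2 hn
    simp only [hn', false_imp_iff, if_true, hn.neg_one_pow]
    linear_combination 2 * (vandermonde x).det * sum_range_pow_mul_one_sub N _ hz
  -- For `n + 1` odd only the term `1` of the series is left; if `N = 0`, the ring is zero.
  · obtain _ | N := N
    · have : Subsingleton S := subsingleton_of_zero_eq_one (by simpa using (hx 0).symm)
      exact Subsingleton.elim _ _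
    · simp [hn, hn.neg_one_pow]

/-! ### The Weyl denominator of type C -/

/-- The palindromic polynomial `1 + x² + ⋯ + x^(2k)` is a combination of the terms
`x ^ i (1 + x²) ^ (k - i)`: a Chebyshev polynomial of the second kind in `x + x⁻¹`, homogenized. -/
theorem exists_geom_sum_sq_eq (S : Type*) [CommRing S] (k : ℕ) : ∃ q : ℕ → ℤ, q 0 = 1 ∧
    ∀ x : S, ∑ j ∈ range (k + 1), (x ^ 2) ^ j =
      ∑ i ∈ range (k + 1), (q i : S) * (x ^ i * (1 + x ^ 2) ^ (k - i)) := by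
  induction k using Nat.twoStepInduction with
  | zero => exact ⟨fun _ => 1, rfl, fun x => by simp⟩
  | one =>
    refine ⟨fun i => if i = 0 then 1 else 0, rfl, fun x => ?_⟩
    simp [Finset.sum_range_succ]
  | more k ih₀ ih₁ =>
    obtain ⟨q₀, -, h₀⟩ := ih₀
    obtain ⟨q₁, hq, h₁⟩ := ih₁
    refine ⟨fun i => (if i ≤ k + 1 then q₁ i else 0) - if 2 ≤ i then q₀ (i - 2) else 0,
      by simp [hq], fun x => ?_⟩
    -- the Chebyshev recursion
    have hrec : ∑ j ∈ range (k + 2 + 1), (x ^ 2) ^ j =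
        (1 + x ^ 2) * ∑ j ∈ range (k + 1 + 1), (x ^ 2) ^ j -
          x ^ 2 * ∑ j ∈ range (k + 1), (x ^ 2) ^ j := by
      rw [Finset.sum_range_succ _ (k + 2), Finset.sum_range_succ _ (k + 1)]
      ring
    have e₁ : ∑ i ∈ range (k + 2 + 1), (((if i ≤ k + 1 then q₁ i else 0 : ℤ)) : S) *
        (x ^ i * (1 + x ^ 2) ^ (k + 2 - i)) =
        (1 + x ^ 2) * ∑ i ∈ range (k + 1 + 1), (q₁ i : S) *
          (x ^ i * (1 + x ^ 2) ^ (k + 1 - i)) := by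
      rw [Finset.sum_range_succ, Finset.mul_sum]
      simp only [show ¬ k + 2 ≤ k + 1 by omega, if_false, Int.cast_zero, zero_mul, add_zero]
      refine Finset.sum_congr rfl fun i hi => ?_
      have hi' : i ≤ k + 1 := Nat.lt_succ_iff.1 (mem_range.1 hi)
      rw [if_pos hi', show k + 2 - i = k + 1 - i + 1 by omega]
      ring
    have e₀ : ∑ i ∈ range (k + 2 + 1), (((if 2 ≤ i then q₀ (i - 2) else 0 : ℤ)) : S) *
        (x ^ i * (1 + x ^ 2) ^ (k + 2 - i)) =
        x ^ 2 * ∑ i ∈ range (k + 1), (q₀ i : S) * (x ^ i * (1 + x ^ 2) ^ (k - i)) := by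
      rw [Finset.sum_range_succ', Finset.sum_range_succ', Finset.mul_sum]
      simp only [Nat.not_ofNat_le_one, show ¬ 2 ≤ 0 by omega, zero_add, if_false, Int.cast_zero,
        zero_mul, add_zero]
      refine Finset.sum_congr rfl fun i _ => ?_
      rw [if_pos (by omega), show k + 2 - (i + 1 + 1) = k - i by omega,
        show i + 1 + 1 - 2 = i by omega]
      ring
    rw [hrec, h₁, h₀, ← e₁, ← e₀, ← Finset.sum_sub_distrib]
    refine Finset.sum_congr rfl fun i _ => ?_
    push_cast
    ring

theorem det_projVandermonde_one_add_sq {S : Type*} [CommRing S] {a : ℕ} (x : Fin a → S) :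
    (projVandermonde x fun i => 1 + x i ^ 2).det = (vandermonde x).det * pairProd x := by
  rw [det_projVandermonde, det_vandermonde, pairProd, ← Finset.prod_mul_distrib]
  refine Finset.prod_congr rfl fun i _ => ?_
  rw [← Finset.prod_mul_distrib]
  refine Finset.prod_congr rfl fun j _ => ?_
  ring

/-- The Weyl denominator formula of type C. Up to the factors `1 - x_i²` and a unitriangular change
of columns, the matrix is the homogeneous Vandermonde matrix in `x_i` and `1 + x_i²`. -/
theorem det_pow_sub_pow {S : Type*} [CommRing S] {a : ℕ} (x : Fin a → S) :
    det (of fun i b : Fin a => x i ^ (b : ℕ) - x i ^ (2 * a - b)) =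
      (∏ i, (1 - x i ^ 2)) * pairProd x * (vandermonde x).det := by
  choose q hq0 hq using exists_geom_sum_sq_eq S
  -- the unitriangular change of columns
  let T : Matrix (Fin a) (Fin a) S := of fun c b =>
    if b ≤ c then ((q (a - 1 - b) (c - b) : ℤ) : S) else 0
  have hT : T.det = 1 := by
    rw [det_of_isLowerTriangular]
    · simp [T, hq0]
    · intro i j hij
      have : ¬ j ≤ i := not_le.2 (by simpa using hij)
      simp [T, this]
  have hM : (of fun i b : Fin a => x i ^ (b : ℕ) - x i ^ (2 * a - b)) =
      of fun i b => (1 - x i ^ 2) * (projVandermonde x (fun i => 1 + x i ^ 2) * T) i b := by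
    ext i b
    simp only [of_apply, mul_apply, projVandermonde_apply, T, Fin.val_rev, Fin.le_def]
    have hb := b.2
    rw [Fin.sum_univ_eq_sum_range (fun c => x i ^ c * (1 + x i ^ 2) ^ (a - (c + 1)) *
        if (b : ℕ) ≤ c then ((q (a - 1 - b) (c - b) : ℤ) : S) else 0) a,
      show range a = range (b + (a - 1 - b + 1)) by congr 1; omega, Finset.sum_range_add,
      Finset.sum_eq_zero (s := range (b : ℕ)), zero_add]
    · have h1 : ∑ c ∈ range (a - 1 - b + 1), x i ^ ((b : ℕ) + c) *
          (1 + x i ^ 2) ^ (a - (b + c + 1)) *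
          (if (b : ℕ) ≤ b + c then ((q (a - 1 - b) (b + c - b) : ℤ) : S) else 0) =
          x i ^ (b : ℕ) * ∑ c ∈ range (a - 1 - b + 1), (q (a - 1 - b) c : S) *
            (x i ^ c * (1 + x i ^ 2) ^ (a - 1 - b - c)) := by
        rw [Finset.mul_sum]
        refine Finset.sum_congr rfl fun c _ => ?_
        rw [if_pos (by omega), show a - (b + c + 1) = a - 1 - b - c by omega,
          Nat.add_sub_cancel_left, pow_add]
        ring
      rw [h1, ← hq]
      have h2 := geom_sum_mul_neg (x i ^ 2) (a - 1 - b + 1)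
      have h3 : x i ^ (2 * a - b) = x i ^ (b : ℕ) * (x i ^ 2) ^ (a - 1 - b + 1) := by
        rw [← pow_mul, ← pow_add]; congr 1; omega
      rw [h3]
      linear_combination -x i ^ (b : ℕ) * h2
    · intro c hc
      rw [if_neg (by simpa using hc), mul_zero]
  rw [hM, det_mul_column, det_mul, hT, det_projVandermonde_one_add_sq]
  ring

/-! ### Evaluating power series at nilpotent elements -/

/-- The value `G(x)` of a power series at `x`, computed from the terms of degree below `N`. It is
meaningful when `x ^ N = 0`, and then multiplicative in `G`. -/
noncomputable def evalNilp {R S : Type*} [CommRing R] [CommRing S] [Algebra R S] (N : ℕ) (x : S)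
    (G : PowerSeries R) : S :=
  Polynomial.aeval x (PowerSeries.trunc N G)

theorem evalNilp_eq_sum {R S : Type*} [CommRing R] [CommRing S] [Algebra R S] (N : ℕ) (x : S)
    (G : PowerSeries R) :
    evalNilp N x G = ∑ k : Fin N, algebraMap R S (PowerSeries.coeff k G) * x ^ (k : ℕ) := by
  rw [evalNilp, Polynomial.aeval_def, PowerSeries.eval₂_trunc_eq_sum_range,
    Finset.sum_range fun k => algebraMap R S (PowerSeries.coeff k G) * x ^ k]

/-- At an element with `x ^ N = 0`, the truncation at `N` does not change the value of a polynomial.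
-/
theorem evalNilp_coe {R S : Type*} [CommRing R] [CommRing S] [Algebra R S] {N : ℕ} {x : S}
    (hx : x ^ N = 0) (p : Polynomial R) :
    evalNilp N x (p : PowerSeries R) = Polynomial.aeval x p := by
  have h : (Polynomial.X : Polynomial R) ^ N ∣ p - PowerSeries.trunc N (p : PowerSeries R) := by
    rw [Polynomial.X_pow_dvd_iff]
    intro d hd
    rw [Polynomial.coeff_sub, PowerSeries.coeff_trunc, if_pos hd, Polynomial.coeff_coe, sub_self]
  obtain ⟨q, hq⟩ := h
  have := congrArg (Polynomial.aeval x) hq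
  rw [map_sub, map_mul, map_pow, Polynomial.aeval_X, hx, zero_mul, sub_eq_zero] at this
  rw [evalNilp, this]

theorem evalNilp_mul {R S : Type*} [CommRing R] [CommRing S] [Algebra R S] {N : ℕ} {x : S}
    (hx : x ^ N = 0) (F G : PowerSeries R) :
    evalNilp N x (F * G) = evalNilp N x F * evalNilp N x G := by
  have h : evalNilp N x (F * G) =
      evalNilp N x ((PowerSeries.trunc N F * PowerSeries.trunc N G : Polynomial R) :
        PowerSeries R) := by
    rw [evalNilp, evalNilp, Polynomial.coe_mul, PowerSeries.trunc_trunc_mul_trunc]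
  rw [h, evalNilp_coe hx, map_mul]
  rfl

/-- Multilinear expansion of the alternant of several power series. -/
theorem det_evalNilp {R S : Type*} [CommRing R] [CommRing S] [Algebra R S] (N : ℕ) {a : ℕ}
    (x : Fin a → S) (G : Fin a → PowerSeries R) :
    det (of fun i j => evalNilp N (x i) (G j)) = ∑ k : Fin a → Fin N,
      algebraMap R S (det (of fun i j => PowerSeries.coeff (k i) (G j))) *
        ∏ i, x i ^ (k i : ℕ) := by
  have h : (of fun i j => evalNilp N (x i) (G j)) = fun i => ∑ k : Fin N,
      fun j => x i ^ (k : ℕ) * algebraMap R S (PowerSeries.coeff k (G j)) := by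
    ext i j
    rw [Finset.sum_apply, of_apply, evalNilp_eq_sum]
    exact Finset.sum_congr rfl fun k _ => mul_comm _ _
  have h2 := (detRowAlternating (R := S) (n := Fin a)).toMultilinearMap.map_sum
    (fun (i : Fin a) (k : Fin N) (j : Fin a) =>
      x i ^ (k : ℕ) * algebraMap R S (PowerSeries.coeff k (G j)))
  rw [h]
  refine h2.trans (Finset.sum_congr rfl fun k _ => ?_)
  rw [RingHom.map_det, mul_comm]
  exact det_mul_column (fun i => x i ^ (k i : ℕ))
    ((algebraMap R S).mapMatrix (of fun i j => PowerSeries.coeff (k i) (G j)))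

/-! ### Coefficients of alternants and the complement in a rectangle -/

section coefficients
open MvPolynomial

theorem prod_X_pow_eq_monomial_one {R : Type*} [CommRing R] {a : ℕ} (k : Fin a → ℕ) :
    ∏ i, (X i : MvPolynomial (Fin a) R) ^ k i = monomial (Finsupp.equivFunOnFinite.symm k) 1 := by
  rw [monomial_eq, Finsupp.prod_fintype _ _ (by simp)]
  simp

theorem coeff_det_evalNilp {R : Type*} [CommRing R] {N a : ℕ} (G : Fin a → PowerSeries R)
    (k : Fin a → ℕ) (hk : ∀ i, k i < N) :
    coeff (Finsupp.equivFunOnFinite.symm k)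
      (det (of fun i j => evalNilp N (X i : MvPolynomial (Fin a) R) (G j))) =
      det (of fun i j => PowerSeries.coeff (k i) (G j)) := by
  rw [det_evalNilp, coeff_sum, Finset.sum_eq_single fun i => ⟨k i, hk i⟩]
  · simp only [algebraMap_eq, coeff_C_mul, prod_X_pow_eq_monomial_one, coeff_monomial, if_true,
      mul_one]
  · intro l _ hl
    rw [algebraMap_eq, coeff_C_mul, prod_X_pow_eq_monomial_one, coeff_monomial, if_neg, mul_zero]
    intro h
    refine hl (funext fun i => Fin.ext ?_)
    exact congrFun (Finsupp.equivFunOnFinite.symm.injective h) i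
  · simp

/-- The ideal generated by the `N`-th powers of the variables. -/
noncomputable def powIdeal (R : Type*) [CommRing R] (a N : ℕ) : Ideal (MvPolynomial (Fin a) R) :=
  Ideal.span ((fun s => monomial s (1 : R)) '' Set.range fun i : Fin a => Finsupp.single i N)

theorem X_pow_mem_powIdeal (R : Type*) [CommRing R] {a : ℕ} (N : ℕ) (i : Fin a) :
    X i ^ N ∈ powIdeal R a N := by
  rw [X_pow_eq_monomial]
  exact Ideal.subset_span ⟨_, ⟨i, rfl⟩, rfl⟩

theorem coeff_eq_of_mk_eq {R : Type*} [CommRing R] {a N : ℕ} {p q : MvPolynomial (Fin a) R}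
    (h : Ideal.Quotient.mk (powIdeal R a N) p = Ideal.Quotient.mk (powIdeal R a N) q)
    (k : Fin a →₀ ℕ) (hk : ∀ i, k i < N) : coeff k p = coeff k q := by
  rw [Ideal.Quotient.eq, powIdeal, mem_ideal_span_monomial_image] at h
  rw [← sub_eq_zero, ← coeff_sub]
  by_contra hne
  obtain ⟨_, ⟨i, rfl⟩, hi⟩ := h k (mem_support_iff.2 hne)
  have := hi i
  rw [Finsupp.single_eq_same] at this
  exact (hk i).not_ge this

/-- The coefficient of `p` at an integer exponent vector; it is `0` if some exponent is negative. -/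
noncomputable def coeffInt {R : Type*} [CommRing R] {a : ℕ} (p : MvPolynomial (Fin a) R)
    (n : Fin a → ℤ) : R :=
  if ∀ i, 0 ≤ n i then coeff (Finsupp.equivFunOnFinite.symm fun i => (n i).toNat) p else 0

theorem coeffInt_comp_perm {R : Type*} [CommRing R] {a : ℕ} {p : MvPolynomial (Fin a) R}
    (hp : p.IsSymmetric) (n : Fin a → ℤ) (σ : Equiv.Perm (Fin a)) :
    coeffInt p (n ∘ σ) = coeffInt p n := by
  have h1 : (∀ i, 0 ≤ (n ∘ σ) i) ↔ ∀ i, 0 ≤ n i :=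
    σ.forall_congr_left (p := fun i => 0 ≤ n (σ i)) |>.trans (by simp)
  rw [coeffInt, coeffInt]
  simp only [h1]
  split_ifs
  · have h2 := coeff_rename_mapDomain σ σ.injective p
      (Finsupp.equivFunOnFinite.symm fun i => ((n ∘ σ) i).toNat)
    rw [hp σ] at h2
    rw [← h2]
    congr 1
    ext i
    rw [← Equiv.apply_symm_apply σ i, Finsupp.mapDomain_apply σ.injective]
    simp
  · rfl

theorem coeff_mul_det_pow {R : Type*} [CommRing R] {a : ℕ} (p : MvPolynomial (Fin a) R)
    (e k : Fin a → ℕ) :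
    coeff (Finsupp.equivFunOnFinite.symm k)
      (p * det (of fun i j => (X i : MvPolynomial (Fin a) R) ^ e j)) =
      ∑ σ : Equiv.Perm (Fin a), ((Equiv.Perm.sign σ : ℤ) : R) *
        coeffInt p fun i => (k i : ℤ) - e (σ i) := by
  rw [← det_transpose, det_apply', Finset.mul_sum, coeff_sum]
  refine Finset.sum_congr rfl fun σ _ => ?_
  simp only [transpose_apply, of_apply]
  rw [prod_X_pow_eq_monomial_one, mul_left_comm,
    show (((Equiv.Perm.sign σ : ℤ) : ℤ) : MvPolynomial (Fin a) R) = C ((Equiv.Perm.sign σ : ℤ) : R)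
      by simp, coeff_C_mul, coeff_mul_monomial', mul_one, coeffInt]
  congr 1
  have h1 : (Finsupp.equivFunOnFinite.symm fun i => e (σ i)) ≤ Finsupp.equivFunOnFinite.symm k ↔
      ∀ i, (0 : ℤ) ≤ (k i : ℤ) - e (σ i) := by
    rw [Finsupp.le_def]
    exact forall_congr' fun i => by simp
  simp only [h1]
  refine if_congr Iff.rfl ?_ rfl
  congr 1
  ext i
  simp

/-- Multiplication by a symmetric `p` pairs the alternant with exponents `e` and the top monomial
`∏ X_i ^ (m + i)` in the same way as the Vandermonde determinant and the monomial with the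
complementary exponents `m + a - 1 - e`, in reverse order. Both sides are signed sums over the
permutations, matched by `σ ↦ rev σ⁻¹ rev`. -/
theorem coeff_mul_det_pow_duality {R : Type*} [CommRing R] {a : ℕ} {p : MvPolynomial (Fin a) R}
    (hp : p.IsSymmetric) (m : ℕ) (e : Fin a → ℕ) :
    coeff (Finsupp.equivFunOnFinite.symm fun i : Fin a => m + (i : ℕ))
      (p * det (of fun i j => (X i : MvPolynomial (Fin a) R) ^ e j)) =
    if ∀ j, e j ≤ m + a - 1 then
      coeff (Finsupp.equivFunOnFinite.symm fun i : Fin a => m + a - 1 - e i.rev)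
        (p * (vandermonde (X : Fin a → MvPolynomial (Fin a) R)).det) else 0 := by
  rw [coeff_mul_det_pow]
  split_ifs with h
  · rw [vandermonde, coeff_mul_det_pow p (fun j => (j : ℕ))]
    let φ : Equiv.Perm (Fin a) ≃ Equiv.Perm (Fin a) :=
      (Equiv.inv _).trans (MulAut.conj (Fin.revPerm : Equiv.Perm (Fin a))).toEquiv
    refine Fintype.sum_equiv φ _ _ fun σ => ?_
    have hs : Equiv.Perm.sign (φ σ) = Equiv.Perm.sign σ := by
      simp only [φ, Equiv.trans_apply, Equiv.inv_apply, MulEquiv.toEquiv_eq_coe,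
        MulEquiv.coe_toEquiv, MulAut.conj_apply, map_mul, map_inv]
      rw [mul_right_comm, mul_inv_cancel, one_mul]
      simp
    rw [hs, ← coeffInt_comp_perm hp _ (σ⁻¹ * Fin.revPerm)]
    congr 2
    ext i
    have hi := i.2
    have h1 := h i.rev
    have h2 : φ σ i = (σ⁻¹ i.rev).rev := by
      simp [φ, Equiv.Perm.mul_apply]
    have h3 := (σ⁻¹ i.rev).2
    simp only [Function.comp_apply, Equiv.Perm.mul_apply, h2, Fin.val_rev, Fin.revPerm_apply,
      show σ (σ⁻¹ i.rev) = i.rev from σ.apply_symm_apply _]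
    omega
  · push Not at h
    obtain ⟨j, hj⟩ := h
    refine Finset.sum_eq_zero fun σ _ => ?_
    rw [coeffInt, if_neg, mul_zero]
    push Not
    refine ⟨σ⁻¹ j, ?_⟩
    have := (σ⁻¹ j).2
    rw [show σ (σ⁻¹ j) = j from σ.apply_symm_apply j]
    omega

end coefficients

/-! ### Rectangles as sums of bracket determinants -/

theorem map_evalNilp {R S T : Type*} [CommRing R] [CommRing S] [CommRing T] [Algebra R S]
    [Algebra R T] (φ : S →ₐ[R] T) (N : ℕ) (x : S) (G : PowerSeries R) :
    φ (evalNilp N x G) = evalNilp N (φ x) G :=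
  (Polynomial.aeval_algHom_apply φ x _).symm

theorem map_pairProd {S T : Type*} [CommRing S] [CommRing T] (φ : S →+* T) {n : ℕ}
    (x : Fin n → S) : φ (pairProd x) = pairProd fun i => φ (x i) := by
  simp [pairProd, map_prod]

theorem map_det_vandermonde {S T : Type*} [CommRing S] [CommRing T] (φ : S →+* T) {n : ℕ}
    (x : Fin n → S) : φ (vandermonde x).det = (vandermonde fun i => φ (x i)).det := by
  simp [det_vandermonde, map_prod]

theorem map_littlewoodSum {S T : Type*} [CommRing S] [CommRing T] (φ : S →+* T)
    (p : ℕ → ℕ → Prop) (N : ℕ) {n : ℕ} (x : Fin n → S) :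
    φ (littlewoodSum p N x) = littlewoodSum p N fun i => φ (x i) := by
  simp only [littlewoodSum, map_sum]
  refine Finset.sum_congr rfl fun d _ => ?_
  split_ifs
  · rw [RingHom.map_det]
    congr 1
    ext i j
    simp
  · simp

/-- The coefficient of `G` at an integer exponent; it is `0` at negative exponents. -/
noncomputable def coeffZ {R : Type*} [CommRing R] (G : PowerSeries R) (n : ℤ) : R :=
  if 0 ≤ n then PowerSeries.coeff n.toNat G else 0

theorem coeff_mul_X_pow_eq_coeffZ {R : Type*} [CommRing R] (G : PowerSeries R) (n b : ℕ) :
    PowerSeries.coeff n (G * PowerSeries.X ^ b) = coeffZ G (n - b) := by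
  rw [PowerSeries.coeff_mul_X_pow', coeffZ]
  exact if_congr (by omega) (by congr 2; omega) rfl

/-- The determinant `det_{1 ≤ i, j ≤ a} (g_{f_i - i + j} - g_{f_i - i - j})` of `S_[f]`, formed with
the coefficients of a power series `G`, and of arbitrary size `a`. -/
noncomputable def bracketDet {R : Type*} [CommRing R] (G : PowerSeries R) {a : ℕ}
    (f : Fin a → ℕ) : R :=
  det (of fun i j : Fin a => coeffZ G ((f i : ℤ) - ((i : ℤ) + 1) + ((j : ℤ) + 1)) -
    coeffZ G ((f i : ℤ) - ((i : ℤ) + 1) - ((j : ℤ) + 1)))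

/-- In reverse order of rows and columns, the entries are coefficients of the products of `G` with
the columns of the Weyl denominator of type C. -/
theorem bracketDet_eq {R : Type*} [CommRing R] (G : PowerSeries R) {a : ℕ} (f : Fin a → ℕ) :
    bracketDet G f = det (of fun i b : Fin a => PowerSeries.coeff (f i.rev + i)
      (G * (PowerSeries.X ^ (b : ℕ) - PowerSeries.X ^ (2 * a - b)))) := by
  rw [bracketDet, ← det_submatrix_equiv_self Fin.revPerm]
  congr 1
  ext i b
  have hi := i.2
  have hb := b.2
  simp only [submatrix_apply, of_apply, Fin.revPerm_apply, mul_sub, map_sub,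
    coeff_mul_X_pow_eq_coeffZ, Fin.val_rev]
  congr 2 <;> omega

theorem gapSum_mono {a : ℕ} (d : Fin a → ℕ) {i j : Fin a} (h : i ≤ j) :
    gapSum d i ≤ gapSum d j := by
  refine Finset.sum_le_sum fun l _ => ?_
  by_cases hl : l ≤ i
  · simp [hl, hl.trans h]
  · simp [hl]

theorem gapSum_add_le_iff {a : ℕ} (d : Fin a → ℕ) (m : ℕ) :
    (∀ j, gapSum d j + j ≤ m + a - 1) ↔ ∀ j, gapSum d j ≤ m := by
  constructor
  · intro h j
    have hj := j.2
    have h1 := h ⟨a - 1, by omega⟩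
    have h2 := gapSum_mono d (i := j) (j := ⟨a - 1, by omega⟩) (by rw [Fin.le_def]; simp; omega)
    simp only at h1
    omega
  · intro h j
    have := h j
    have := j.2
    omega

open Classical in
/-- The Jacobi–Trudi determinant of the rectangle `(m ^ a)` for `F` is a sum of bracket determinants
for `G`, provided that the Littlewood sum for `p` has the right value at nilpotent elements. The
partition with parts `m - gapSum d i` is the complement in the rectangle of the one that indexes the
alternant, and the condition `gapSum d j ≤ m` says that it lies in the rectangle. -/
theorem sum_bracketDet_eq {R : Type*} [CommRing R] (p : ℕ → ℕ → Prop) (m a : ℕ)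
    (G F : PowerSeries R)
    (h : ∀ x : Fin a → MvPolynomial (Fin a) R ⧸ powIdeal R a (m + a),
      (∀ i, x i ^ (m + a) = 0) →
      (∏ i, evalNilp (m + a) (x i) G) * ((∏ i, (1 - x i ^ 2)) * pairProd x) *
        littlewoodSum p (m + a) x =
      (∏ i, evalNilp (m + a) (x i) F) * (vandermonde x).det) :
    (∑ d : Fin a → Fin (m + a), if (∀ j : Fin a, p (a - j) (d j)) ∧
        ∀ j, gapSum (fun l => (d l : ℕ)) j ≤ m then
      bracketDet G (fun i => m - gapSum (fun l => (d l : ℕ)) i) else 0) =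
    det (of fun i j : Fin a => coeffZ F ((m : ℤ) - ((i : ℤ) + 1) + ((j : ℤ) + 1))) := by
  set N := m + a with hN
  let P := MvPolynomial (Fin a) R
  let Q := P ⧸ powIdeal R a N
  let φ : P →ₐ[R] Q := Ideal.Quotient.mkₐ R (powIdeal R a N)
  let z : Fin a → P := MvPolynomial.X
  let A : P := (∏ i, evalNilp N (z i) G) * ((∏ i, (1 - z i ^ 2)) * pairProd z)
  have hz : ∀ i, φ (z i) ^ N = 0 := fun i => by
    rw [← map_pow]
    exact Ideal.Quotient.eq_zero_iff_mem.2 (X_pow_mem_powIdeal R N i)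
  have hA : A.IsSymmetric := by
    intro σ
    have h1 : MvPolynomial.rename σ (pairProd z) = pairProd z :=
      (map_pairProd (MvPolynomial.rename σ : P →ₐ[R] P).toRingHom z).trans
        ((congrArg pairProd (funext fun i => by simp [z])).trans (pairProd_comp_perm z σ))
    simp only [A, map_mul, map_prod, h1, map_evalNilp, map_sub, map_one, map_pow, z,
      MvPolynomial.rename_X]
    rw [Equiv.prod_comp σ fun i => evalNilp N (MvPolynomial.X i : P) G,
      Equiv.prod_comp σ fun i => 1 - (MvPolynomial.X i : P) ^ 2]
  have hφA : φ A = (∏ i, evalNilp N (φ (z i)) G) *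
      ((∏ i, (1 - φ (z i) ^ 2)) * pairProd fun i => φ (z i)) := by
    have h1 : φ (pairProd z) = pairProd fun i => φ (z i) := map_pairProd φ.toRingHom z
    simp only [A, map_mul, map_prod, map_evalNilp, h1, map_sub, map_one, map_pow]
  have hφV : φ (vandermonde z).det = (vandermonde fun i => φ (z i)).det :=
    map_det_vandermonde φ.toRingHom z
  have hφL : φ (littlewoodSum p N z) = littlewoodSum p N fun i => φ (z i) :=
    map_littlewoodSum φ.toRingHom p N z
  have hpow : ∀ (i : Fin a) (b : ℕ), evalNilp N (φ (z i)) (PowerSeries.X ^ b : PowerSeries R) =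
      φ (z i) ^ b := fun i b => by
    have := evalNilp_coe (hz i) (Polynomial.X ^ b : Polynomial R)
    rwa [Polynomial.coe_pow, Polynomial.coe_X, map_pow, Polynomial.aeval_X] at this
  have hsub : ∀ (i : Fin a) (b c : ℕ), evalNilp N (φ (z i))
      (PowerSeries.X ^ b - PowerSeries.X ^ c : PowerSeries R) =
      φ (z i) ^ b - φ (z i) ^ c := fun i b c => by
    rw [← hpow, ← hpow, evalNilp, map_sub, map_sub]
    rfl
  have hdet : ∀ H : Fin a → PowerSeries R,
      φ (det (of fun i j => evalNilp N (z i) (H j))) =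
        det (of fun i j => evalNilp N (φ (z i)) (H j)) := fun H => by
    rw [AlgHom.map_det]
    congr 1
    ext i j
    exact map_evalNilp φ N (z i) (H j)
  -- Weyl's denominator formula gives the coefficients of `A V`.
  have hAV : φ (A * (vandermonde z).det) = φ (det (of fun i b : Fin a => evalNilp N (z i)
      (G * (PowerSeries.X ^ (b : ℕ) - PowerSeries.X ^ (2 * a - b))))) := by
    rw [hdet, map_mul, hφA, hφV, mul_assoc, ← det_pow_sub_pow, ← det_mul_column]
    congr 1
    ext i b
    simp only [of_apply, evalNilp_mul (hz i), hsub]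
  -- The Littlewood identity evaluates `A` times the sum of alternants.
  have hAL : φ (A * littlewoodSum p N z) = φ (det (of fun i j : Fin a => evalNilp N (z i)
      (F * PowerSeries.X ^ (j : ℕ)))) := by
    rw [hdet, map_mul, hφA, hφL, h _ hz, ← det_mul_column]
    congr 1
    ext i b
    simp only [of_apply, vandermonde_apply, evalNilp_mul (hz i), hpow]
  have htop : det (of fun i j : Fin a => coeffZ F ((m : ℤ) - ((i : ℤ) + 1) + ((j : ℤ) + 1))) =
      MvPolynomial.coeff (Finsupp.equivFunOnFinite.symm fun i : Fin a => m + (i : ℕ))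
        (A * littlewoodSum p N z) := by
    rw [coeff_eq_of_mk_eq hAL _ fun i => by simp [hN], coeff_det_evalNilp _ _ fun i => by simp [hN],
      ← det_transpose]
    congr 1
    ext i j
    simp only [transpose_apply, of_apply, coeff_mul_X_pow_eq_coeffZ]
    congr 1
    push_cast
    ring
  rw [htop, littlewoodSum, Finset.mul_sum, MvPolynomial.coeff_sum]
  refine Finset.sum_congr rfl fun d _ => ?_
  by_cases hd : ∀ j : Fin a, p (a - j) (d j)
  · simp only [hd, implies_true, true_and, if_true]
    rw [coeff_mul_det_pow_duality hA]
    simp only [gapSum_add_le_iff]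
    refine ite_congr rfl (fun hm => ?_) fun _ => rfl
    rw [bracketDet_eq, coeff_eq_of_mk_eq hAV _ fun i => ?_, coeff_det_evalNilp _ _ fun i => ?_]
    · congr 1
      ext i b
      have := hm i.rev
      have := i.2
      simp only [of_apply, Fin.val_rev]
      congr 2
      omega
    · have := i.2
      omega
    · have := i.2
      simp only [Finsupp.coe_equivFunOnFinite_symm]
      omega
  · simp only [hd, false_and, if_false, mul_zero, MvPolynomial.coeff_zero]

/-! ### Partitions in a rectangle and gap sequences -/

theorem gapSum_zero {a : ℕ} (d : Fin a → ℕ) (h : 0 < a) : gapSum d ⟨0, h⟩ = d ⟨0, h⟩ := by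
  rw [gapSum, Finset.sum_eq_single ⟨0, h⟩]
  · simp
  · intro l _ hl
    rw [if_neg]
    exact fun h' => hl (Fin.ext (Nat.le_zero.1 h'))
  · simp

theorem gapSum_succ {a : ℕ} (d : Fin a → ℕ) {i : ℕ} (h : i + 1 < a) :
    gapSum d ⟨i + 1, h⟩ = gapSum d ⟨i, by omega⟩ + d ⟨i + 1, h⟩ := by
  have h1 : d ⟨i + 1, h⟩ = ∑ l, if l = ⟨i + 1, h⟩ then d l else 0 := by simp
  rw [h1, gapSum, gapSum, ← Finset.sum_add_distrib]
  refine Finset.sum_congr rfl fun l _ => ?_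
  simp only [Fin.le_def, Fin.ext_iff]
  rcases lt_trichotomy (l : ℕ) (i + 1) with hl | hl | hl
  · simp [hl.le, hl.ne, Nat.lt_succ_iff.1 hl]
  · simp [hl]
  · simp [hl.not_ge, hl.ne', show ¬ (l : ℕ) ≤ i by omega]

/-- The gaps `m - μ_1, μ_1 - μ_2, μ_2 - μ_3, …` of a partition with parts at most `m`. They encode
the complement of `μ` in the rectangle: its parts are the partial sums of the gaps. -/
def rowGap (m : ℕ) (μ : YoungDiagram) : ℕ → ℕ
  | 0 => m - μ.rowLen 0
  | j + 1 => μ.rowLen j - μ.rowLen (j + 1)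

theorem gapSum_rowGap {m a : ℕ} {μ : YoungDiagram} (hμ : μ.rowLen 0 ≤ m) (j : Fin a) :
    gapSum (fun l : Fin a => rowGap m μ l) j = m - μ.rowLen j := by
  obtain ⟨j, hj⟩ := j
  induction j with
  | zero => rw [gapSum_zero]; rfl
  | succ j ih =>
    rw [gapSum_succ, ih (by omega)]
    have h1 := μ.rowLen_anti j (j + 1) (by omega)
    have h2 := μ.rowLen_anti 0 j (by omega)
    simp only [rowGap]
    omega

theorem mem_boxPartitions {m a : ℕ} {μ : YoungDiagram} :
    μ ∈ boxPartitions m a ↔ μ.colLen 0 ≤ a ∧ μ.rowLen 0 ≤ m := by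
  simp [boxPartitions]

theorem rowLen_eq_zero_of_colLen_le {μ : YoungDiagram} {i : ℕ} (h : μ.colLen 0 ≤ i) :
    μ.rowLen i = 0 := by
  by_contra hne
  have h1 : (i, 0) ∈ μ := YoungDiagram.mem_iff_lt_rowLen.2 (Nat.pos_of_ne_zero hne)
  exact (YoungDiagram.mem_iff_lt_colLen.1 h1).not_ge h

theorem ext_of_rowLen {μ ν : YoungDiagram} (h : ∀ i, μ.rowLen i = ν.rowLen i) : μ = ν := by
  refine YoungDiagram.ext (Finset.ext fun ⟨i, j⟩ => ?_)
  simp only [YoungDiagram.mem_cells, YoungDiagram.mem_iff_lt_rowLen, h]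

theorem rowGap_le {m a : ℕ} {μ : YoungDiagram} (h : μ ∈ boxPartitions m a) (j : ℕ) :
    rowGap m μ j ≤ m := by
  have h0 := (mem_boxPartitions.1 h).2
  cases j with
  | zero => simp [rowGap]
  | succ j =>
    have h1 := μ.rowLen_anti 0 j (by omega)
    simp only [rowGap]
    omega

/-- The partition with at most `a` parts whose gaps are `d`; its parts are `m - (d_0 + ⋯ + d_i)`. -/
def diagramOfGaps (m : ℕ) {a : ℕ} (d : Fin a → ℕ) : YoungDiagram where
  cells := (range a ×ˢ range m).filter fun c => ∃ h : c.1 < a, c.2 < m - gapSum d ⟨c.1, h⟩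
  isLowerSet := by
    rintro ⟨i, j⟩ ⟨i', j'⟩ ⟨h1, h2⟩ h
    simp only [coe_filter, mem_product, mem_range, Set.mem_ofPred_eq] at h h1 h2 ⊢
    obtain ⟨⟨h3, h4⟩, h5, h6⟩ := h
    have h7 := gapSum_mono d (i := ⟨i', by omega⟩) (j := ⟨i, h5⟩) h1
    exact ⟨⟨by omega, by omega⟩, by omega, by omega⟩

theorem mem_diagramOfGaps {m a : ℕ} {d : Fin a → ℕ} {i j : ℕ} :
    (i, j) ∈ diagramOfGaps m d ↔ ∃ h : i < a, j < m - gapSum d ⟨i, h⟩ := by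
  rw [← YoungDiagram.mem_cells, diagramOfGaps, mem_filter, mem_product, mem_range, mem_range]
  constructor
  · exact fun h => h.2
  · rintro ⟨h, h'⟩
    exact ⟨⟨h, by simp only; omega⟩, h, h'⟩

theorem rowLen_diagramOfGaps {m a : ℕ} (d : Fin a → ℕ) (i : Fin a) :
    (diagramOfGaps m d).rowLen i = m - gapSum d i := by
  refine eq_of_forall_lt_iff fun j => ?_
  rw [← YoungDiagram.mem_iff_lt_rowLen, mem_diagramOfGaps]
  simp

theorem diagramOfGaps_mem_boxPartitions {m a : ℕ} (d : Fin a → ℕ) :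
    diagramOfGaps m d ∈ boxPartitions m a := by
  rw [mem_boxPartitions]
  constructor
  · by_contra! h
    obtain ⟨h', -⟩ := mem_diagramOfGaps.1 (YoungDiagram.mem_iff_lt_colLen.2 h)
    exact lt_irrefl _ h'
  · by_contra! h
    obtain ⟨h', h''⟩ := mem_diagramOfGaps.1 (YoungDiagram.mem_iff_lt_rowLen.2 h)
    omega

theorem rowGap_diagramOfGaps {m a : ℕ} {d : Fin a → ℕ} (hd : ∀ j, gapSum d j ≤ m) (j : Fin a) :
    rowGap m (diagramOfGaps m d) j = d j := by
  obtain ⟨j, hj⟩ := j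
  cases j with
  | zero =>
    have h1 := rowLen_diagramOfGaps (m := m) d ⟨0, hj⟩
    have h2 := hd ⟨0, hj⟩
    rw [gapSum_zero] at h1 h2
    simp only [rowGap] at h1 ⊢
    omega
  | succ j =>
    have h1 := rowLen_diagramOfGaps (m := m) d ⟨j + 1, hj⟩
    have h2 := rowLen_diagramOfGaps (m := m) d ⟨j, by omega⟩
    have h3 := hd ⟨j + 1, hj⟩
    rw [gapSum_succ] at h1 h3
    simp only [rowGap] at h1 h2 ⊢
    omega

open Classical in
/-- Reindexing of a sum over partitions in the box by their gaps. -/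
theorem sum_boxPartitions_filter_eq {R : Type*} [CommRing R] {m a : ℕ} (ha : 1 ≤ a)
    (q : YoungDiagram → Prop) [DecidablePred q] (p : ℕ → ℕ → Prop)
    (hq : ∀ μ ∈ boxPartitions m a, q μ ↔ ∀ j : Fin a, p (a - j) (rowGap m μ j))
    (T : (Fin a → ℕ) → R) :
    ∑ μ ∈ (boxPartitions m a).filter q, T (fun i => μ.rowLen i) =
      ∑ d : Fin a → Fin (m + a), if (∀ j : Fin a, p (a - j) (d j)) ∧
        ∀ j, gapSum (fun l => (d l : ℕ)) j ≤ m then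
      T (fun i => m - gapSum (fun l => (d l : ℕ)) i) else 0 := by
  rw [← Finset.sum_filter]
  refine Finset.sum_bij'
    (fun μ hμ j => ⟨rowGap m μ j, by have := rowGap_le (mem_filter.1 hμ).1 j; omega⟩)
    (fun d _ => diagramOfGaps m fun l => (d l : ℕ)) ?_ ?_ ?_ ?_ ?_
  · intro μ hμ
    obtain ⟨hb, hμ⟩ := mem_filter.1 hμ
    refine mem_filter.2 ⟨mem_univ _, (hq μ hb).1 hμ, fun j => ?_⟩
    simp only [gapSum_rowGap (mem_boxPartitions.1 hb).2]
    omega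
  · intro d hd
    obtain ⟨-, hp, hm⟩ := mem_filter.1 hd
    refine mem_filter.2 ⟨diagramOfGaps_mem_boxPartitions _, ?_⟩
    rw [hq _ (diagramOfGaps_mem_boxPartitions _)]
    intro j
    rw [rowGap_diagramOfGaps hm]
    exact hp j
  · intro μ hμ
    obtain ⟨hb, hμ⟩ := mem_filter.1 hμ
    obtain ⟨hc, hr⟩ := mem_boxPartitions.1 hb
    refine ext_of_rowLen fun i => ?_
    by_cases hi : i < a
    · rw [rowLen_diagramOfGaps _ ⟨i, hi⟩]
      simp only [gapSum_rowGap hr]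
      have := μ.rowLen_anti 0 i (by omega)
      omega
    · rw [rowLen_eq_zero_of_colLen_le (μ := μ) (by omega), rowLen_eq_zero_of_colLen_le]
      exact (mem_boxPartitions.1 (diagramOfGaps_mem_boxPartitions _)).1.trans (by omega)
  · intro d hd
    obtain ⟨-, hp, hm⟩ := mem_filter.1 hd
    ext j
    exact rowGap_diagramOfGaps hm j
  · intro μ hμ
    obtain ⟨hb, hμ⟩ := mem_filter.1 hμ
    obtain ⟨hc, hr⟩ := mem_boxPartitions.1 hb
    congr 1
    ext i
    simp only [gapSum_rowGap hr]
    have := μ.rowLen_anti 0 i (by omega)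
    omega

/-! ### Independence of the bracket determinant of its size -/

theorem det_fin_succ_of_last_row {R : Type*} [CommRing R] (E : ℕ → ℕ → R) (n : ℕ)
    (h0 : ∀ j < n, E n j = 0) (h1 : E n n = 1) :
    det (of fun i j : Fin (n + 1) => E i j) = det (of fun i j : Fin n => E i j) := by
  rw [det_succ_row _ (Fin.last n), Fin.sum_univ_castSucc, Finset.sum_eq_zero, zero_add]
  · have h : (of fun i j : Fin (n + 1) => E i j).submatrix (Fin.last n).succAbove
        (Fin.last n).succAbove = of fun i j : Fin n => E i j := by
      ext i j; simp
    rw [h]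
    simp [h1, ← two_mul]
  · intro j _
    simp [h0 j j.2]

/-- Empty rows do not change the bracket determinant. -/
theorem bracketDet_rowLen_eq {R : Type*} [CommRing R] {G : PowerSeries R}
    (hG : PowerSeries.constantCoeff G = 1) {μ : YoungDiagram} {a : ℕ} (h : μ.colLen 0 ≤ a) :
    bracketDet G (fun i : Fin a => μ.rowLen i) =
      bracketDet G (fun i : Fin (μ.colLen 0) => μ.rowLen i) := by
  induction a, h using Nat.le_induction with
  | base => rfl
  | succ n hn ih =>
    rw [← ih]
    refine det_fin_succ_of_last_row (fun i j => coeffZ G ((μ.rowLen i : ℤ) - ((i : ℤ) + 1) +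
      ((j : ℤ) + 1)) - coeffZ G ((μ.rowLen i : ℤ) - ((i : ℤ) + 1) - ((j : ℤ) + 1))) n ?_ ?_
    · intro j hj
      rw [rowLen_eq_zero_of_colLen_le hn, coeffZ, coeffZ, if_neg (by omega), if_neg (by omega),
        sub_zero]
    · rw [rowLen_eq_zero_of_colLen_le hn, coeffZ, coeffZ, if_pos (by omega), if_neg (by omega),
        sub_zero, ← hG, ← PowerSeries.coeff_zero_eq_constantCoeff_apply]
      congr 2
      omega

/-! ### Rectangular determinants and the substitution `t ↦ -t` -/

theorem card_eq_sum_rowLen (μ : YoungDiagram) :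
    μ.card = ∑ i : Fin (μ.colLen 0), μ.rowLen i := by
  change μ.cells.card = _
  rw [← Finset.sum_range fun i => μ.rowLen i,
    Finset.card_eq_sum_card_fiberwise (f := Prod.fst) (t := range (μ.colLen 0))]
  · exact Finset.sum_congr rfl fun i _ => (μ.rowLen_eq_card).symm
  · rintro ⟨i, j⟩ h
    rw [Finset.mem_coe, YoungDiagram.mem_cells] at h
    have := μ.up_left_mem le_rfl (Nat.zero_le j) h
    simpa using YoungDiagram.mem_iff_lt_colLen.1 this

theorem coeff_rescale_mul {R : Type*} [CommRing R] (G : PowerSeries R) (n b c : ℕ)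
    (hbc : Even (b + c)) :
    PowerSeries.coeff n (PowerSeries.rescale (-1 : R) G *
      (PowerSeries.X ^ b - PowerSeries.X ^ c)) =
      (-1) ^ n *
        ((-1) ^ b * PowerSeries.coeff n (G * (PowerSeries.X ^ b - PowerSeries.X ^ c))) := by
  have h : PowerSeries.rescale (-1 : R) (G * (PowerSeries.X ^ b - PowerSeries.X ^ c)) =
      PowerSeries.C ((-1) ^ b : R) *
        (PowerSeries.rescale (-1 : R) G * (PowerSeries.X ^ b - PowerSeries.X ^ c)) := by
    have hc : (-1 : R) ^ c = (-1) ^ b := by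
      rcases Nat.even_or_odd b with hb | hb
      · rw [hb.neg_one_pow, ((Nat.even_add.1 hbc).1 hb).neg_one_pow]
      · rw [hb.neg_one_pow, ((Nat.even_add'.1 hbc).1 hb).neg_one_pow]
    rw [map_mul, map_sub, map_pow, map_pow, PowerSeries.rescale_X, mul_pow, mul_pow, ← map_pow,
      ← map_pow, hc]
    ring
  have h2 := congrArg (PowerSeries.coeff n) h
  rw [PowerSeries.coeff_rescale, PowerSeries.coeff_C_mul] at h2
  rw [mul_left_comm, h2, ← mul_assoc, ← mul_pow]
  simp

theorem bracketDet_rescale {R : Type*} [CommRing R] (G : PowerSeries R) {a : ℕ} (f : Fin a → ℕ) :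
    bracketDet (PowerSeries.rescale (-1 : R) G) f = (-1) ^ (∑ i, f i) * bracketDet G f := by
  rw [bracketDet_eq, bracketDet_eq]
  have h : (of fun i b : Fin a => PowerSeries.coeff (f i.rev + i) (PowerSeries.rescale (-1 : R) G *
      (PowerSeries.X ^ (b : ℕ) - PowerSeries.X ^ (2 * a - b)))) =
      of fun i b : Fin a => (-1) ^ (f i.rev + i) * (of fun i b : Fin a => (-1) ^ (b : ℕ) *
        (of fun i b : Fin a => PowerSeries.coeff (f i.rev + i)
          (G * (PowerSeries.X ^ (b : ℕ) - PowerSeries.X ^ (2 * a - b)))) i b) i b := by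
    ext i b
    have hb := b.2
    exact coeff_rescale_mul G _ _ _ ⟨a, by omega⟩
  rw [h, det_mul_column, det_mul_row, ← mul_assoc]
  congr 1
  rw [Finset.prod_pow_eq_pow_sum, Finset.prod_pow_eq_pow_sum, ← pow_add, Finset.sum_add_distrib,
    add_assoc, pow_add, ← two_mul, pow_mul, neg_one_sq, one_pow, mul_one,
    Equiv.sum_comp Fin.revPerm f |> fun h => (by simpa using h : ∑ i, f (Fin.rev i) = ∑ i, f i)]

/-- The Jacobi–Trudi determinant of the rectangle `(m ^ a)`, formed with the coefficients of a power
series. -/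
noncomputable def rectDet {R : Type*} [CommRing R] (m a : ℕ) (F : PowerSeries R) : R :=
  det (of fun i j : Fin a => coeffZ F ((m : ℤ) - ((i : ℤ) + 1) + ((j : ℤ) + 1)))

theorem rectDet_rescale {R : Type*} [CommRing R] (m a : ℕ) (F : PowerSeries R) :
    rectDet m a (PowerSeries.rescale (-1 : R) F) = (-1) ^ (m * a) * rectDet m a F := by
  have h : (of fun i j : Fin a => coeffZ (PowerSeries.rescale (-1 : R) F)
      ((m : ℤ) - ((i : ℤ) + 1) + ((j : ℤ) + 1))) =
      of fun i j : Fin a => (-1) ^ (m + i : ℕ) * (of fun i j : Fin a => (-1) ^ (j : ℕ) *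
        (of fun i j : Fin a => coeffZ F ((m : ℤ) - ((i : ℤ) + 1) + ((j : ℤ) + 1))) i j) i j := by
    ext i j
    simp only [of_apply, coeffZ]
    split_ifs with hn
    · rw [PowerSeries.coeff_rescale, ← mul_assoc, ← pow_add]
      congr 1
      have : m + (i : ℕ) + j = ((m : ℤ) - ((i : ℤ) + 1) + ((j : ℤ) + 1)).toNat + 2 * i := by omega
      rw [this, pow_add, pow_mul, neg_one_sq, one_pow, mul_one]
    · simp
  rw [rectDet, h, det_mul_column, det_mul_row, ← mul_assoc, rectDet]
  congr 1
  rw [Finset.prod_pow_eq_pow_sum, Finset.prod_pow_eq_pow_sum, ← pow_add, Finset.sum_add_distrib,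
    add_assoc, pow_add, ← two_mul, pow_mul (-1 : R) 2, neg_one_sq, one_pow, mul_one]
  simp [mul_comm]

/-! ### Supersymmetric Schur functions through power series -/

theorem colLen_rectDiagram {m a : ℕ} (hm : 1 ≤ m) : (rectDiagram m a).colLen 0 = a := by
  refine eq_of_forall_lt_iff fun i => ?_
  rw [← YoungDiagram.mem_iff_lt_colLen, ← YoungDiagram.mem_cells, rectDiagram]
  simp
  omega

theorem rowLen_rectDiagram {m a i : ℕ} (hi : i < a) : (rectDiagram m a).rowLen i = m := by
  refine eq_of_forall_lt_iff fun j => ?_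
  rw [← YoungDiagram.mem_iff_lt_rowLen, ← YoungDiagram.mem_cells, rectDiagram]
  simp
  omega

theorem superSchur_rectDiagram {R : Type*} [CommRing R] {m a : ℕ} (hm : 1 ≤ m)
    (X Y : Multiset R) :
    superSchur (rectDiagram m a) X Y = rectDet m a (superGen X Y) := by
  have h : ∀ n, n = a → det (of fun i j : Fin n => superH X Y
      (((rectDiagram m a).rowLen i : ℤ) - ((i : ℤ) + 1) + ((j : ℤ) + 1))) =
      rectDet m a (superGen X Y) := by
    rintro n rfl
    rw [rectDet]
    congr 1
    ext i j
    rw [of_apply, of_apply, rowLen_rectDiagram i.2]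
    rfl
  exact h _ (colLen_rectDiagram hm)

theorem coeffZ_one_sub_X_sq_mul {R : Type*} [CommRing R] (G : PowerSeries R) (k : ℤ) :
    coeffZ ((1 - PowerSeries.X ^ 2) * G) k = coeffZ G k - coeffZ G (k - 2) := by
  by_cases hk : 0 ≤ k
  · lift k to ℕ using hk
    rw [sub_mul, one_mul, mul_comm _ G, coeffZ, if_pos (by omega), Int.toNat_natCast, map_sub,
      coeff_mul_X_pow_eq_coeffZ]
    simp [coeffZ]
  · rw [coeffZ, coeffZ, coeffZ, if_neg hk, if_neg hk, if_neg (by omega), sub_zero]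

/-- The column operations behind `S_⟨μ⟩(X|Y) = S_[μ](X ⊔ {1, -1}|Y)`: each column on the left is the
difference of the columns on the right with indices `j` and `j - 2`. The columns on the right are
odd in their index, so that the column of index `1` is doubled, and the column of index `0` is zero.
-/
theorem det_add_eq_two_mul_det_sub {R : Type*} [CommRing R] (n : ℕ) (g h : ℤ → R)
    (hgh : ∀ k, h k = g k - g (k - 2)) (r : Fin (n + 1) → ℤ) :
    det (of fun i j : Fin (n + 1) => h (r i + ((j : ℤ) + 1)) + h (r i - ((j : ℤ) + 1) + 2)) =
      2 * det (of fun i j : Fin (n + 1) => g (r i + ((j : ℤ) + 1)) - g (r i - ((j : ℤ) + 1))) := by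
  let U : Matrix (Fin (n + 1)) (Fin (n + 1)) R := of fun k j =>
    (if k = j then if j = 0 then 2 else 1 else 0) - if (k : ℕ) + 2 = j then 1 else 0
  have hU : U.det = 2 := by
    rw [det_of_isUpperTriangular]
    · simp [U]
    · intro k j hkj
      have hkj' : j < k := hkj
      have h1 : ¬ k = j := hkj'.ne'
      have h2 : ¬ (k : ℕ) + 2 = j := by have : (j : ℕ) < k := hkj'; omega
      simp [U, h1, h2]
  rw [mul_comm, ← hU, ← det_mul]
  congr 1
  ext i j
  simp only [mul_apply, of_apply, U, mul_sub, Finset.sum_sub_distrib, mul_ite, mul_one, mul_zero,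
    Finset.sum_ite_eq', mem_univ, if_true]
  -- The subtracted column has index `j - 2`; for the first two columns there is none.
  obtain ⟨j, hj⟩ := j
  match j, hj with
  | 0, hj =>
    simp [hgh]
    ring_nf
  | 1, hj =>
    rw [Finset.sum_eq_zero fun k _ => if_neg (by simp)]
    simp [hgh]
  | j + 2, hj =>
    rw [Finset.sum_eq_single ⟨j, by omega⟩]
    · simp [hgh]
      ring_nf
    · intro k _ hk
      rw [if_neg]
      intro h
      exact hk (Fin.ext (by simpa using h))
    · simp

/-- The factor `1/2` cancels against the doubled first column. -/
theorem superSchurC_eq_bracketDet {R : Type*} [CommRing R] [Invertible (2 : R)] (μ : YoungDiagram)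
    (X Y : Multiset R) (G : PowerSeries R) (hG : superGen X Y = (1 - PowerSeries.X ^ 2) * G) :
    superSchurC μ X Y = bracketDet G (fun i : Fin (μ.colLen 0) => μ.rowLen i) := by
  rw [superSchurC]
  split_ifs with h
  · subst h
    have h0 : (⊥ : YoungDiagram).colLen 0 = 0 := by
      by_contra hne
      exact YoungDiagram.notMem_bot _ (YoungDiagram.mem_iff_lt_colLen.2 (Nat.pos_of_ne_zero hne))
    have : IsEmpty (Fin ((⊥ : YoungDiagram).colLen 0)) := by rw [h0]; infer_instance
    rw [bracketDet, det_isEmpty]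
  · have hn : μ.colLen 0 ≠ 0 := by
      intro h0
      refine h (ext_of_rowLen fun i => ?_)
      rw [rowLen_eq_zero_of_colLen_le (h0.le.trans (Nat.zero_le i))]
      by_contra hne
      exact YoungDiagram.notMem_bot _
        (YoungDiagram.mem_iff_lt_rowLen.2 (Nat.pos_of_ne_zero (Ne.symm hne)))
    have key : ∀ n, n ≠ 0 → det (of fun i j : Fin n =>
        superH X Y ((μ.rowLen i : ℤ) - ((i : ℤ) + 1) + ((j : ℤ) + 1)) +
          superH X Y ((μ.rowLen i : ℤ) - ((i : ℤ) + 1) - ((j : ℤ) + 1) + 2)) =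
        2 * bracketDet G (fun i : Fin n => μ.rowLen i) := by
      rintro n hn
      obtain ⟨n, rfl⟩ := Nat.exists_eq_succ_of_ne_zero hn
      refine det_add_eq_two_mul_det_sub n (coeffZ G) (superH X Y) (fun k => ?_)
        (fun i => (μ.rowLen i : ℤ) - ((i : ℤ) + 1))
      rw [← coeffZ_one_sub_X_sq_mul, ← hG]
      rfl
    rw [key _ hn, invOf_mul_cancel_left']

theorem superSchurBD_eq_bracketDet {R : Type*} [CommRing R] (μ : YoungDiagram)
    (X Y : Multiset R) : superSchurBD μ X Y =
      bracketDet (superGen X Y) (fun i : Fin (μ.colLen 0) => μ.rowLen i) := rfl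

theorem constantCoeff_superGen {R : Type*} [CommRing R] (X Y : Multiset R) :
    PowerSeries.constantCoeff (superGen X Y) = 1 := by
  have h := congrArg PowerSeries.constantCoeff (superGen_mul X Y)
  rw [map_mul, map_multiset_prod, map_multiset_prod, Multiset.map_map, Multiset.map_map] at h
  simpa using h

theorem superGen_add_right {R : Type*} [CommRing R] (X Y Z : Multiset R) :
    superGen X (Y + Z) =
      (Z.map fun z => 1 - PowerSeries.C z * PowerSeries.X).prod * superGen X Y := by
  rw [superGen, superGen, Multiset.map_add, Multiset.prod_add]
  ring

theorem superGen_eq_mul_superGen_add_left {R : Type*} [CommRing R] (X Y Z : Multiset R) :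
    superGen X Y =
      (Z.map fun z => 1 - PowerSeries.C z * PowerSeries.X).prod * superGen (X + Z) Y := by
  have hu : IsUnit (X.map fun x : R => 1 - PowerSeries.C x * PowerSeries.X).prod := by
    rw [PowerSeries.isUnit_iff_constantCoeff, map_multiset_prod, Multiset.map_map]
    simp
  refine hu.mul_right_cancel ?_
  rw [superGen_mul, ← superGen_mul (X + Z) Y, Multiset.map_add, Multiset.prod_add]
  ring

/-! ### The rectangle identities for an arbitrary power series -/

open Classical in
/-- The rectangle as a sum over a set of partitions, given the Littlewood identity for the
complements. -/
theorem rectDet_eq_sum {R : Type*} [CommRing R] {m a : ℕ} (ha : 1 ≤ a)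
    (q : YoungDiagram → Prop) [DecidablePred q] (p : ℕ → ℕ → Prop)
    (hq : ∀ μ ∈ boxPartitions m a, q μ ↔ ∀ j : Fin a, p (a - j) (rowGap m μ j))
    {G F : PowerSeries R} (hG : PowerSeries.constantCoeff G = 1)
    (h : ∀ x : Fin a → MvPolynomial (Fin a) R ⧸ powIdeal R a (m + a),
      (∀ i, x i ^ (m + a) = 0) →
      (∏ i, evalNilp (m + a) (x i) G) * ((∏ i, (1 - x i ^ 2)) * pairProd x) *
        littlewoodSum p (m + a) x =
      (∏ i, evalNilp (m + a) (x i) F) * (vandermonde x).det) :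
    rectDet m a F = ∑ μ ∈ (boxPartitions m a).filter q,
      bracketDet G (fun i : Fin (μ.colLen 0) => μ.rowLen i) := by
  rw [rectDet, ← sum_bracketDet_eq p m a G F h,
    ← sum_boxPartitions_filter_eq ha q p hq (bracketDet G)]
  refine Finset.sum_congr rfl fun μ hμ => ?_
  exact bracketDet_rowLen_eq hG (mem_boxPartitions.1 (mem_filter.1 hμ).1).1

/-- A partition is in the horizontal domino set if and only if its complement has even parts. -/
theorem horizontal_domino_iff {m a : ℕ} {μ : YoungDiagram} (hμ : μ.rowLen 0 ≤ m) :
    ((Odd m → ∀ i : ℕ, i < a → Odd (μ.rowLen i)) ∧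
      (Even m → ∀ i : ℕ, i < a → Even (μ.rowLen i))) ↔
    ∀ j : Fin a, Even (rowGap m μ j) := by
  have h1 : ((Odd m → ∀ i : ℕ, i < a → Odd (μ.rowLen i)) ∧
      (Even m → ∀ i : ℕ, i < a → Even (μ.rowLen i))) ↔ ∀ i < a, Even (m - μ.rowLen i) := by
    constructor
    · rintro ⟨h1, h2⟩ i hi
      have := μ.rowLen_anti 0 i (by omega)
      rcases Nat.even_or_odd m with hm | hm
      · have := h2 hm i hi
        grind
      · have := h1 hm i hi
        grind
    · intro h
      constructor <;>
      · intro hm i hi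
        have := μ.rowLen_anti 0 i (by omega)
        have := h i hi
        grind
  rw [h1]
  constructor
  · rintro h ⟨j, hj⟩
    cases j with
    | zero => exact h 0 hj
    | succ j =>
      have := h (j + 1) hj
      have := h j (by omega)
      have := μ.rowLen_anti 0 j (by omega)
      have := μ.rowLen_anti j (j + 1) (by omega)
      simp only [rowGap]
      grind
  · intro h i hi
    induction i with
    | zero => exact h ⟨0, hi⟩
    | succ i ih =>
      have := h ⟨i + 1, hi⟩
      have := ih (by omega)
      have := μ.rowLen_anti 0 i (by omega)
      have := μ.rowLen_anti i (i + 1) (by omega)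
      simp only [rowGap] at *
      grind

/-- A partition is in the vertical domino set if and only if its complement has columns of even
length. -/
theorem vertical_domino_iff {m a : ℕ} {μ : YoungDiagram} (hμ : μ.rowLen 0 ≤ m) :
    ((Odd a → μ.rowLen 0 = m ∧
        ∀ k : ℕ, 2 * k + 2 < a → μ.rowLen (2 * k + 1) = μ.rowLen (2 * k + 2)) ∧
      (Even a → ∀ k : ℕ, 2 * k + 1 < a → μ.rowLen (2 * k) = μ.rowLen (2 * k + 1))) ↔
    ∀ j : Fin a, Odd (a - (j : ℕ)) → rowGap m μ j = 0 := by
  constructor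
  · rintro ⟨h1, h2⟩ ⟨j, hj⟩ hodd
    rcases Nat.even_or_odd a with ha | ha
    · obtain ⟨k, rfl⟩ : ∃ k, j = 2 * k + 1 := ⟨j / 2, by
        simp only [Nat.odd_iff] at hodd
        rw [Nat.even_iff] at ha
        omega⟩
      simp only [rowGap, h2 ha k hj, Nat.sub_self]
    · match j, hj with
      | 0, hj => simp [rowGap, (h1 ha).1]
      | j + 1, hj =>
        obtain ⟨k, rfl⟩ : ∃ k, j = 2 * k + 1 := ⟨j / 2, by
          simp only [Nat.odd_iff] at hodd ha
          omega⟩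
        simp only [rowGap, (h1 ha).2 k hj, Nat.sub_self]
  · intro h
    refine ⟨fun ha => ⟨?_, fun k hk => ?_⟩, fun ha k hk => ?_⟩
    · have := h ⟨0, ha.pos⟩ (by simpa using ha)
      simp only [rowGap] at this
      omega
    · have h1 := h ⟨2 * k + 1 + 1, hk⟩ (by simp only; grind)
      have h2 := μ.rowLen_anti (2 * k + 1) (2 * k + 1 + 1) (by omega)
      simp only [rowGap] at h1
      exact (h2.antisymm (Nat.sub_eq_zero_iff_le.1 h1)).symm
    · have := h ⟨2 * k + 1, hk⟩ (by simp only; grind)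
      have := μ.rowLen_anti (2 * k) (2 * k + 1) (by omega)
      simp only [rowGap] at *
      omega

theorem evalNilp_one_add_X_mul {R S : Type*} [CommRing R] [CommRing S] [Algebra R S] {N : ℕ}
    {x : S} (hx : x ^ N = 0) (G : PowerSeries R) :
    evalNilp N x ((1 + PowerSeries.X) * G) = (1 + x) * evalNilp N x G := by
  rw [evalNilp_mul hx]
  congr 1
  have h := evalNilp_coe hx (1 + Polynomial.X : Polynomial R)
  rw [Polynomial.coe_add, Polynomial.coe_one, Polynomial.coe_X] at h
  simpa using h

theorem evalNilp_one_sub_X_sq_mul {R S : Type*} [CommRing R] [CommRing S] [Algebra R S] {N : ℕ}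
    {x : S} (hx : x ^ N = 0) (G : PowerSeries R) :
    evalNilp N x ((1 - PowerSeries.X ^ 2) * G) = (1 - x ^ 2) * evalNilp N x G := by
  rw [evalNilp_mul hx]
  congr 1
  have h := evalNilp_coe hx (1 - Polynomial.X ^ 2 : Polynomial R)
  have h2 : ((1 - Polynomial.X ^ 2 : Polynomial R) : PowerSeries R) = 1 - PowerSeries.X ^ 2 := by
    ext n
    simp [PowerSeries.coeff_one, PowerSeries.coeff_X_pow]
  rw [h2] at h
  simpa using h

open Classical in
theorem rectDet_eq_sum_horizontal {R : Type*} [CommRing R] {m a : ℕ} (ha : 1 ≤ a)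
    {G : PowerSeries R} (hG : PowerSeries.constantCoeff G = 1) :
    rectDet m a G = ∑ μ ∈ horizontalDominoPartitions m a,
      bracketDet G (fun i : Fin (μ.colLen 0) => μ.rowLen i) := by
  refine rectDet_eq_sum (m := m) ha _ (fun _ c => Even c)
    (fun μ hμ => horizontal_domino_iff (mem_boxPartitions.1 hμ).2) hG fun x hx => ?_
  rw [← littlewoodSum_even_mul x hx]
  ring

theorem rectDet_one_add_X_mul_eq_sum_box {R : Type*} [CommRing R] {m a : ℕ} (ha : 1 ≤ a)
    {G : PowerSeries R} (hG : PowerSeries.constantCoeff G = 1) :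
    rectDet m a ((1 + PowerSeries.X) * G) = ∑ μ ∈ boxPartitions m a,
      bracketDet G (fun i : Fin (μ.colLen 0) => μ.rowLen i) := by
  classical
  have h := rectDet_eq_sum (m := m) ha (fun _ => True) (fun _ _ => True) (fun μ _ => by simp)
    (F := (1 + PowerSeries.X) * G) hG fun x hx => ?_
  · rw [h, Finset.filter_true]
  · rw [← littlewoodSum_true_mul x hx]
    have h1 : ∏ i, (1 - x i ^ 2) = (∏ i, (1 + x i)) * ∏ i, (1 - x i) := by
      rw [← Finset.prod_mul_distrib]
      exact Finset.prod_congr rfl fun i _ => by ring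
    simp only [evalNilp_one_add_X_mul (hx _), Finset.prod_mul_distrib, h1]
    ring

open Classical in
theorem rectDet_one_sub_X_sq_mul_eq_sum_vertical {R : Type*} [CommRing R] [Invertible (2 : R)]
    {m a : ℕ} (ha : 1 ≤ a) {G : PowerSeries R} (hG : PowerSeries.constantCoeff G = 1) :
    rectDet m a ((1 - PowerSeries.X ^ 2) * G) = ∑ μ ∈ verticalDominoPartitions m a,
      bracketDet G (fun i : Fin (μ.colLen 0) => μ.rowLen i) := by
  refine rectDet_eq_sum (m := m) ha _ (fun r c => Odd r → c = 0)
    (fun μ hμ => vertical_domino_iff (mem_boxPartitions.1 hμ).2) hG fun x hx => ?_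
  have h2 : IsUnit (2 : MvPolynomial (Fin a) R ⧸ powIdeal R a (m + a)) := by
    have := (isUnit_of_invertible (2 : R)).map
      (algebraMap R (MvPolynomial (Fin a) R ⧸ powIdeal R a (m + a)))
    rwa [map_ofNat] at this
  rw [← littlewoodSum_vertical_mul h2 x hx]
  simp only [evalNilp_one_sub_X_sq_mul (hx _), Finset.prod_mul_distrib]
  ring

theorem rectDet_one_sub_X_mul_eq_sum_box {R : Type*} [CommRing R] {m a : ℕ} (ha : 1 ≤ a)
    {G : PowerSeries R} (hG : PowerSeries.constantCoeff G = 1) :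
    rectDet m a ((1 - PowerSeries.X) * G) = ∑ μ ∈ boxPartitions m a,
      (-1) ^ (m * a + μ.card) * bracketDet G (fun i : Fin (μ.colLen 0) => μ.rowLen i) := by
  have h := rectDet_one_add_X_mul_eq_sum_box (m := m) ha (G := PowerSeries.rescale (-1 : R) G) (by
    rw [← PowerSeries.coeff_zero_eq_constantCoeff_apply, PowerSeries.coeff_rescale, pow_zero,
      one_mul, PowerSeries.coeff_zero_eq_constantCoeff_apply, hG])
  have h1 : (1 + PowerSeries.X) * PowerSeries.rescale (-1 : R) G =
      PowerSeries.rescale (-1 : R) ((1 - PowerSeries.X) * G) := by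
    rw [map_mul, map_sub, map_one, PowerSeries.rescale_X]
    simp
  rw [h1, rectDet_rescale] at h
  have h2 : rectDet m a ((1 - PowerSeries.X) * G) = (-1) ^ (m * a) *
      ((-1) ^ (m * a) * rectDet m a ((1 - PowerSeries.X) * G)) := by
    rw [← mul_assoc, ← mul_pow]
    simp
  rw [h2, h, Finset.mul_sum]
  refine Finset.sum_congr rfl fun μ _ => ?_
  rw [bracketDet_rescale, card_eq_sum_rowLen, pow_add, mul_assoc]

end

theorem mainTheorem3 {R : Type*} [CommRing R] [Invertible (2 : R)] (m a : ℕ)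
    (hm : 1 ≤ m) (ha : 1 ≤ a) :
    (∀ (r s : ℕ) (x : Fin r → Rˣ) (y : Fin s → Rˣ),
      -- `osp(2r+1|2s)^(1)`: on type B, on type D
      (superSchur (rectDiagram m a) (withInverses x) (withInverses y + {-1}) =
          ∑ μ ∈ verticalDominoPartitions m a,
            superSchurBD μ (withInverses x + {1}) (withInverses y) ∧
        superSchur (rectDiagram m a) (withInverses x) (withInverses y + {-1}) =
          ∑ μ ∈ boxPartitions m a, superSchurBD μ (withInverses x) (withInverses y)) ∧
      -- `sl(2r|2s+1)^(2)`: on type B', on type D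
      (superSchur (rectDiagram m a) (withInverses x) (withInverses y + {1}) =
          ∑ μ ∈ verticalDominoPartitions m a,
            superSchurBD μ (withInverses x + {-1}) (withInverses y) ∧
        superSchur (rectDiagram m a) (withInverses x) (withInverses y + {1}) =
          ∑ μ ∈ boxPartitions m a,
            (-1 : R) ^ (m * a + μ.card) * superSchurBD μ (withInverses x) (withInverses y)) ∧
      -- `sl(2r+1|2s)^(2)`: on type B, on type C
      (superSchur (rectDiagram m a) (withInverses x + {1}) (withInverses y) =
          ∑ μ ∈ horizontalDominoPartitions m a,
            superSchurBD μ (withInverses x + {1}) (withInverses y) ∧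
        superSchur (rectDiagram m a) (withInverses x + {1}) (withInverses y) =
          ∑ μ ∈ boxPartitions m a, superSchurC μ (withInverses x) (withInverses y)) ∧
      -- `sl(2r|2s)^(2)`: on type D, on type C
      (superSchur (rectDiagram m a) (withInverses x) (withInverses y) =
          ∑ μ ∈ horizontalDominoPartitions m a,
            superSchurBD μ (withInverses x) (withInverses y) ∧
        superSchur (rectDiagram m a) (withInverses x) (withInverses y) =
          ∑ μ ∈ verticalDominoPartitions m a,
            superSchurC μ (withInverses x) (withInverses y)) ∧
      -- `osp(2r|2s)^(1)`: on type D
      superSchur (rectDiagram m a) (withInverses x) (withInverses y + {1, -1}) =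
          ∑ μ ∈ verticalDominoPartitions m a,
            superSchurBD μ (withInverses x) (withInverses y) ∧
      -- `spo(2r|2s)^(1)`: on type C
      superSchur (rectDiagram m a) (withInverses x + {1, -1}) (withInverses y) =
          ∑ μ ∈ horizontalDominoPartitions m a,
            superSchurC μ (withInverses x) (withInverses y)) ∧
    -- `osp(2r|2s)^(2)`, `r ≥ 1`: on type B
    (∀ (r s : ℕ) (_ : 1 ≤ r) (x : Fin (r - 1) → Rˣ) (y : Fin s → Rˣ),
      superSchur (rectDiagram m a) (withInverses x + {1, 1}) (withInverses y + {1, -1}) =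
          superSchur (rectDiagram m a) (withInverses x + {1}) (withInverses y + {-1}) ∧
        superSchur (rectDiagram m a) (withInverses x + {1}) (withInverses y + {-1}) =
          ∑ μ ∈ boxPartitions m a,
            superSchurBD μ (withInverses x + {1}) (withInverses y)) := by
  -- An additional variable multiplies or divides the generating series by a linear factor.
  have hX : ∀ X Y : Multiset R, superGen X Y = (1 - PowerSeries.X) * superGen (X + {1}) Y :=
    fun X Y => by simpa using superGen_eq_mul_superGen_add_left X Y {1}
  have hX' : ∀ X Y : Multiset R, superGen X Y = (1 + PowerSeries.X) * superGen (X + {-1}) Y :=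
    fun X Y => by simpa using superGen_eq_mul_superGen_add_left X Y {-1}
  have hXX : ∀ X Y : Multiset R,
      superGen X Y = (1 - PowerSeries.X ^ 2) * superGen (X + {1, -1}) Y := fun X Y => by
    have h := superGen_eq_mul_superGen_add_left X Y {1, -1}
    simp only [Multiset.insert_eq_cons, Multiset.map_cons, Multiset.map_singleton,
      Multiset.prod_cons, Multiset.prod_singleton, map_one, map_neg] at h
    linear_combination h
  have hY : ∀ X Y : Multiset R, superGen X (Y + {1}) = (1 - PowerSeries.X) * superGen X Y :=
    fun X Y => by simpa using superGen_add_right X Y {1}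
  have hY' : ∀ X Y : Multiset R, superGen X (Y + {-1}) = (1 + PowerSeries.X) * superGen X Y :=
    fun X Y => by simpa using superGen_add_right X Y {-1}
  have hYY : ∀ X Y : Multiset R,
      superGen X (Y + {1, -1}) = (1 - PowerSeries.X ^ 2) * superGen X Y := fun X Y => by
    have h := superGen_add_right X Y {1, -1}
    simp only [Multiset.insert_eq_cons, Multiset.map_cons, Multiset.map_singleton,
      Multiset.prod_cons, Multiset.prod_singleton, map_one, map_neg] at h
    linear_combination h
  -- All symplectic characters are orthogonal ones with the two additional variables `1`, `-1`.
  have hC : ∀ (μ : YoungDiagram) (X Y : Multiset R),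
      superSchurC μ X Y = superSchurBD μ (X + {1, -1}) Y := fun μ X Y =>
    superSchurC_eq_bracketDet μ X Y _ (hXX X Y)
  have hc := constantCoeff_superGen (R := R)
  simp only [superSchur_rectDiagram hm, hC, superSchurBD_eq_bracketDet]
  refine ⟨fun r s x y => ⟨⟨?_, ?_⟩, ⟨?_, ?_⟩, ⟨?_, ?_⟩, ⟨?_, ?_⟩, ?_, ?_⟩,
    fun r s _ x y => ⟨?_, ?_⟩⟩
  · rw [← rectDet_one_sub_X_sq_mul_eq_sum_vertical ha (hc _ _), hY', hX (withInverses x)]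
    ring_nf
  · rw [← rectDet_one_add_X_mul_eq_sum_box ha (hc _ _), hY']
  · rw [← rectDet_one_sub_X_sq_mul_eq_sum_vertical ha (hc _ _), hY, hX' (withInverses x)]
    ring_nf
  · rw [← rectDet_one_sub_X_mul_eq_sum_box ha (hc _ _), hY]
  · exact rectDet_eq_sum_horizontal ha (hc _ _)
  · have h : superGen (withInverses x + {1}) (withInverses y) =
        (1 + PowerSeries.X) * superGen (withInverses x + {1, -1}) (withInverses y) := by
      rw [hX' (withInverses x + {1}), add_assoc]
      rfl
    rw [← rectDet_one_add_X_mul_eq_sum_box ha (hc _ _), h]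
  · exact rectDet_eq_sum_horizontal ha (hc _ _)
  · rw [← rectDet_one_sub_X_sq_mul_eq_sum_vertical ha (hc _ _), ← hXX]
  · rw [← rectDet_one_sub_X_sq_mul_eq_sum_vertical ha (hc _ _), hYY]
  · exact rectDet_eq_sum_horizontal ha (hc _ _)
  · have h : superGen (withInverses x + {1, 1}) (withInverses y + {1, -1}) =
        superGen (withInverses x + {1}) (withInverses y + {-1}) := by
      rw [hY', hYY, hX (withInverses x + {1}), add_assoc]
      change _ = (1 + PowerSeries.X) * ((1 - PowerSeries.X) *
        superGen (withInverses x + {1, 1}) (withInverses y))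
      ring
    rw [h]
  · rw [← rectDet_one_add_X_mul_eq_sum_box ha (hc _ _), hY']
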